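/- **Direct second Noether theorem (in a local generating basis).** Let $(x^\lambda,y^i)$, $1\le\lambda\le n$, be the coordinates of a bundle chart of a fibre bundle $Y\to X$, with domain an open set $W\subset\mathbb R^n\times\mathbb R^p$, and let $c^a$ be finitely many odd variables. Symmetric multi-indices are written $\Lambda=(\lambda_1\ldots\lambda_k)$, $|\Lambda|=k$. Put $s^A=(y^i,c^a)$ and let $\mathcal S$ be the algebra of graded functions of finite jet order over $W$, i.e. of finite sums $\sum f\,c^{a_1}_{\Lambda_1}\cdots c^{a_k}_{\Lambda_k}$, where the jet coordinates $c^a_\Lambda$ anticommute and each $f$ is a smooth function of $(x,y)\in W$ and of finitely many jet coordinates $y^i_\Lambda$. Let $d_\lambda=\partial_\lambda+\sum s^A_{\lambda+\Lambda}\,\partial/\partial s^A_\Lambda$ (sum over the distinct jet coordinates) be the total derivatives, with the left partial derivatives for odd variables, $d_\Lambda=d_{\lambda_1}\cdots d_{\lambda_k}$, and $\delta\varphi/\delta s^A=\sum(-1)^{|\Lambda|}d_\Lambda(\partial\varphi/\partial s^A_\Lambda)$ the (left) variational derivative of a density $\varphi\,\omega$, $\omega=dx^1\wedge\cdots\wedge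 dx^n$. On horizontal graded forms $d_H\phi=dx^\lambda\wedge d_\lambda\phi$. Below, sums over multi-indices of coefficients symmetric in $\lambda_1,\ldots,\lambda_k$ are taken over each index $\lambda_i$ separately. For a finite tuple $(f^\Lambda)_{|\Lambda|\le K}$ of graded functions put $$\eta(f)^\Lambda=\sum_{|\Sigma|\le K-|\Lambda|}(-1)^{|\Sigma+\Lambda|}\frac{|\Sigma+\Lambda|!}{|\Sigma|!\,|\Lambda|!}\,d_\Sigma f^{\Sigma+\Lambda}.$$ Let $L=\mathcal L\,\omega$, $\mathcal L\in\mathcal S$, be a graded Lagrangian, $\mathcal E_A=\delta\mathcal L/\delta s^A$, and let $\Delta_r^{A,\Lambda}\in\mathcal S$, $|\Lambda|\le K$, be tuples labelled by a finite set of indices $r$. Adjoin to the variables $s^A$ even or odd ghosts $c^r$ (with their jets $c^r_\Lambda$; the even ones range over $\mathbb R$), and put $$u^A=\sum_r\sum_{|\Lambda|\le K}c^r_\Lambda\,\eta(\Delta^A_r)^\Lambda .$$ Suppose that $\sum_A u^A\mathcal E_A\,\omega=d_H\sigma_0$ for some horizontal graded $(n-1)$-form $\sigma_0$ whose coefficients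 are graded functions of finite jet order of the fields and ghosts. Then the variational derivative $\delta_r$ of this equality with respect to each ghost $c^r$ gives $$\delta_r\Big(\sum_A u^A\mathcal E_A\,\omega\Big)=\sum_A\sum_{\Lambda}(-1)^{|\Lambda|}d_\Lambda\big(\eta(\Delta^A_r)^\Lambda\mathcal E_A\big)=\sum_A\sum_{\Lambda}\eta(\eta(\Delta^A_r))^\Lambda\,d_\Lambda\mathcal E_A=0$$ (coefficients of $\omega$ being meant), and $\eta(\eta(\Delta_r^A))^\Lambda=\Delta_r^{A,\Lambda}$ for all $A$, $\Lambda$; consequently the Noether identities $$\sum_A\sum_{\Lambda}\Delta_r^{A,\Lambda}\,d_\Lambda\mathcal E_A=0$$ hold for every $r$. -/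

import Mathlib

open scoped ContDiff TensorProduct

namespace GradedJets

noncomputable section

/-! ## Jet coordinates over a bundle chart

Symmetric multi-indices over an `n`-dimensional base are multisets `Λ : Multiset (Fin n)`, of
length `|Λ| = Λ.card`; `λ + Λ` is `λ ::ₘ Λ`.  The finite type `E` labels the even coordinates
`y^i`, the finite type `O` the odd ones `c^a`. -/

/-- Coordinates `(x^λ, y^i)` of a bundle chart. -/
abbrev ChartSpace (n : ℕ) (E : Type*) : Type _ := (Fin n → ℝ) × (E → ℝ)

/-- Coordinates `(x^λ, y^i_Λ)`, `0 ≤ |Λ|`, of infinite order jets. -/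
abbrev JetSpace (n : ℕ) (E : Type*) : Type _ := (Fin n → ℝ) × (E × Multiset (Fin n) → ℝ)

variable {n : ℕ} {E O GE GO : Type*}

/-- The projection `(x^λ, y^i_Λ) ↦ (x^λ, y^i)`. -/
def jetProj (j : JetSpace n E) : ChartSpace n E := (j.1, fun i => j.2 (i, 0))

/-- The infinite order jets over the domain `W` of a bundle chart. -/
def JetDom (W : TopologicalSpace.Opens (ChartSpace n E)) : Set (JetSpace n E) :=
  {j | jetProj j ∈ W}

/-- The coordinates `(x^λ, y^i)` together with the jet coordinates in the finite set `S`. -/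
def jetTrunc (S : Finset (E × Multiset (Fin n))) (j : JetSpace n E) :
    ChartSpace n E × (S → ℝ) := (jetProj j, fun s => j.2 s)

/-- `f` is a smooth function of `x^λ`, `y^i` and finitely many jet coordinates `y^i_Λ`.  As there
are finitely many jet coordinates of each order, this means that `f` is (the pull-back of) a smooth
function on the jets of some finite order. -/
def IsSmoothJet [Fintype E] (W : TopologicalSpace.Opens (ChartSpace n E))
    (f : JetDom W → ℝ) : Prop :=
  ∃ (S : Finset (E × Multiset (Fin n))) (g : ChartSpace n E × (S → ℝ) → ℝ),
    ContDiffOn ℝ ∞ g ((W : Set (ChartSpace n E)) ×ˢ Set.univ) ∧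
      ∀ j : JetDom W, f j = g (jetTrunc S j.1)

section Smooth

variable [Fintype E] {W : TopologicalSpace.Opens (ChartSpace n E)}

theorem isSmoothJet_enlarge {f : JetDom W → ℝ} {S T : Finset (E × Multiset (Fin n))} (h : S ⊆ T)
    {g : ChartSpace n E × (S → ℝ) → ℝ}
    (hg : ContDiffOn ℝ ∞ g ((W : Set (ChartSpace n E)) ×ˢ Set.univ))
    (hf : ∀ j : JetDom W, f j = g (jetTrunc S j.1)) :
    ∃ g' : ChartSpace n E × (T → ℝ) → ℝ,
      ContDiffOn ℝ ∞ g' ((W : Set (ChartSpace n E)) ×ˢ Set.univ) ∧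
        ∀ j : JetDom W, f j = g' (jetTrunc T j.1) := by
  refine ⟨fun p => g (p.1, fun s => p.2 ⟨s.1, h s.2⟩), ?_, fun j => hf j⟩
  refine hg.comp (t := (W : Set (ChartSpace n E)) ×ˢ Set.univ) ?_ ?_
  · exact ContDiff.contDiffOn (by fun_prop)
  · intro p hp
    exact ⟨hp.1, trivial⟩

theorem isSmoothJet_pair {f f' : JetDom W → ℝ} (hf : IsSmoothJet W f) (hf' : IsSmoothJet W f') :
    ∃ (S : Finset (E × Multiset (Fin n))) (g g' : ChartSpace n E × (S → ℝ) → ℝ),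
      ContDiffOn ℝ ∞ g ((W : Set (ChartSpace n E)) ×ˢ Set.univ) ∧
      ContDiffOn ℝ ∞ g' ((W : Set (ChartSpace n E)) ×ˢ Set.univ) ∧
      (∀ j : JetDom W, f j = g (jetTrunc S j.1)) ∧
      ∀ j : JetDom W, f' j = g' (jetTrunc S j.1) := by
  classical
  obtain ⟨S, g, hg, hgf⟩ := hf
  obtain ⟨S', g', hg', hgf'⟩ := hf'
  obtain ⟨k, hk, hkf⟩ := isSmoothJet_enlarge (Finset.subset_union_left (s₂ := S')) hg hgf
  obtain ⟨k', hk', hkf'⟩ := isSmoothJet_enlarge (Finset.subset_union_right (s₁ := S)) hg' hgf'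
  exact ⟨_, k, k', hk, hk', hkf, hkf'⟩

end Smooth

/-- The commutative algebra of smooth functions of finite jet order over the chart domain `W`. -/
def JetFun (n : ℕ) (E : Type*) [Fintype E] (W : TopologicalSpace.Opens (ChartSpace n E)) :
    Subalgebra ℝ (JetDom W → ℝ) where
  carrier := {f | IsSmoothJet W f}
  mul_mem' := by
    intro f f' hf hf'
    obtain ⟨S, g, g', hg, hg', h, h'⟩ := isSmoothJet_pair hf hf'
    exact ⟨S, fun p => g p * g' p, hg.mul hg', fun j => by simp [h, h']⟩
  add_mem' := by
    intro f f' hf hf'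
    obtain ⟨S, g, g', hg, hg', h, h'⟩ := isSmoothJet_pair hf hf'
    exact ⟨S, fun p => g p + g' p, hg.add hg', fun j => by simp [h, h']⟩
  algebraMap_mem' := fun r => ⟨∅, fun _ => r, contDiffOn_const, fun _ => rfl⟩

/-- The jet coordinate `y^i_Λ`. -/
def yCoord [Fintype E] (W : TopologicalSpace.Opens (ChartSpace n E)) (i : E)
    (Λ : Multiset (Fin n)) : JetFun n E W :=
  ⟨fun j => j.1.2 (i, Λ), {(i, Λ)}, fun p => p.2 ⟨(i, Λ), by simp⟩,
    ContDiff.contDiffOn (by fun_prop), fun _ => rfl⟩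

/-- Extension of a function by zero to all jets (only used to differentiate it along lines, near
points of its open domain). -/
def extZero (W : TopologicalSpace.Opens (ChartSpace n E)) (f : JetDom W → ℝ)
    (j : JetSpace n E) : ℝ :=
  open Classical in if h : j ∈ JetDom W then f ⟨j, h⟩ else 0

section Deriv

variable [Fintype E] {W : TopologicalSpace.Opens (ChartSpace n E)}

theorem hasDerivAt_line {f : JetDom W → ℝ} {S : Finset (E × Multiset (Fin n))}
    {g : ChartSpace n E × (S → ℝ) → ℝ}
    (hg : ContDiffOn ℝ ∞ g ((W : Set (ChartSpace n E)) ×ˢ Set.univ))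
    (hf : ∀ j : JetDom W, f j = g (jetTrunc S j.1)) (v : JetSpace n E) (j : JetDom W) :
    HasDerivAt (fun t : ℝ => extZero W f (j.1 + t • v))
      (fderiv ℝ g (jetTrunc S j.1) (jetTrunc S v)) 0 := by
  have hopen : IsOpen ((W : Set (ChartSpace n E)) ×ˢ (Set.univ : Set (S → ℝ))) :=
    W.isOpen.prod isOpen_univ
  have hmem : jetTrunc S j.1 ∈ (W : Set (ChartSpace n E)) ×ˢ (Set.univ : Set (S → ℝ)) :=
    ⟨j.2, trivial⟩
  have hlin : ∀ t : ℝ, jetTrunc S (j.1 + t • v) = jetTrunc S j.1 + t • jetTrunc S v :=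
    fun t => rfl
  have hline : HasDerivAt (fun t : ℝ => jetTrunc S j.1 + t • jetTrunc S v) (jetTrunc S v) 0 := by
    simpa using ((hasDerivAt_id (0 : ℝ)).smul_const (jetTrunc S v)).const_add (jetTrunc S j.1)
  have hd : DifferentiableAt ℝ g (jetTrunc S j.1 + (0 : ℝ) • jetTrunc S v) := by
    rw [zero_smul, add_zero]
    exact ((hg.contDiffAt (hopen.mem_nhds hmem)).differentiableAt (by simp))
  have hcomp := hd.hasFDerivAt.comp_hasDerivAt (0 : ℝ) hline
  rw [zero_smul, add_zero] at hcomp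
  refine hcomp.congr_of_eventuallyEq ?_
  have hcont : ContinuousAt (fun t : ℝ => jetTrunc S j.1 + t • jetTrunc S v) 0 :=
    hline.continuousAt
  have hev := hcont.eventually (hopen.mem_nhds (by simpa using hmem))
  filter_upwards [hev] with t ht
  have ht' : j.1 + t • v ∈ JetDom W := ht.1
  rw [extZero, dif_pos ht', hf]
  rfl

theorem differentiableAt_line {f : JetDom W → ℝ} (hf : IsSmoothJet W f) (v : JetSpace n E)
    (j : JetDom W) : DifferentiableAt ℝ (fun t : ℝ => extZero W f (j.1 + t • v)) 0 := by
  obtain ⟨S, g, hg, h⟩ := hf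
  exact (hasDerivAt_line hg h v j).differentiableAt

theorem isSmoothJet_deriv {f : JetDom W → ℝ} (hf : IsSmoothJet W f) (v : JetSpace n E) :
    IsSmoothJet W (fun j => deriv (fun t : ℝ => extZero W f (j.1 + t • v)) 0) := by
  obtain ⟨S, g, hg, h⟩ := hf
  have hopen : IsOpen ((W : Set (ChartSpace n E)) ×ˢ (Set.univ : Set (S → ℝ))) :=
    W.isOpen.prod isOpen_univ
  refine ⟨S, fun p => fderiv ℝ g p (jetTrunc S v), ?_, fun j => (hasDerivAt_line hg h v j).deriv⟩
  exact (hg.fderiv_of_isOpen hopen (by simp)).clm_apply contDiffOn_const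

end Deriv

/-- The derivative of a smooth function of finite jet order in the constant direction `v`. -/
def dirDeriv [Fintype E] (W : TopologicalSpace.Opens (ChartSpace n E)) (v : JetSpace n E) :
    JetFun n E W →ₗ[ℝ] JetFun n E W where
  toFun f := ⟨fun j => deriv (fun t : ℝ => extZero W f.1 (j.1 + t • v)) 0,
    isSmoothJet_deriv f.2 v⟩
  map_add' f g := by
    ext j
    have h := deriv_add (differentiableAt_line f.2 v j) (differentiableAt_line g.2 v j)
    refine Eq.trans (congrArg (fun F => deriv F 0) ?_) h
    funext t
    by_cases ht : j.1 + t • v ∈ JetDom W <;> simp [extZero, ht]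
  map_smul' r f := by
    ext j
    have h := deriv_const_mul r (differentiableAt_line f.2 v j)
    refine Eq.trans (congrArg (fun F => deriv F 0) ?_) h
    funext t
    by_cases ht : j.1 + t • v ∈ JetDom W <;> simp [extZero, ht]

/-- The partial derivative `∂_λ = ∂/∂x^λ` of functions. -/
def bodyDx [Fintype E] (W : TopologicalSpace.Opens (ChartSpace n E)) (l : Fin n) :
    JetFun n E W →ₗ[ℝ] JetFun n E W := dirDeriv W (Pi.single l 1, 0)

/-- The partial derivative `∂/∂y^i_Λ` of functions. -/
def bodyDy [Fintype E] (W : TopologicalSpace.Opens (ChartSpace n E)) (i : E)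
    (Λ : Multiset (Fin n)) : JetFun n E W →ₗ[ℝ] JetFun n E W :=
  open Classical in dirDeriv W (0, Pi.single (i, Λ) 1)

/-! ## Graded functions -/

/-- The Grassmann algebra generated by the odd jet coordinates `c^a_Λ`. -/
abbrev OddJets (n : ℕ) (O : Type*) : Type _ := ExteriorAlgebra ℝ (O × Multiset (Fin n) →₀ ℝ)

/-- Graded functions of finite jet order over the chart domain `W`: finite sums of products
`f c^{a_1}_{Λ_1} ⋯ c^{a_k}_{Λ_k}` with smooth functions `f` of finite jet order. -/
abbrev GrFun (n : ℕ) (E O : Type*) [Fintype E] (W : TopologicalSpace.Opens (ChartSpace n E)) :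
    Type _ := JetFun n E W ⊗[ℝ] OddJets n O

/-- Shortcut to the usual additive structure of a tensor product. -/
instance (n : ℕ) (E O : Type*) [Fintype E] (W : TopologicalSpace.Opens (ChartSpace n E)) :
    AddCommGroup (GrFun n E O W) := TensorProduct.addCommGroup

/-- Shortcut to the usual ring structure of a tensor product of algebras. -/
instance (n : ℕ) (E O : Type*) [Fintype E] (W : TopologicalSpace.Opens (ChartSpace n E)) :
    Ring (GrFun n E O W) := Algebra.TensorProduct.instRing

variable [Fintype E] {W : TopologicalSpace.Opens (ChartSpace n E)}

/-- The jet coordinates `s^A_Λ`, where `s^A` are the even and odd coordinates `y^i`, `c^a`. -/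
def sCoord (W : TopologicalSpace.Opens (ChartSpace n E)) :
    E ⊕ O → Multiset (Fin n) → GrFun n E O W
  | .inl i, Λ => yCoord W i Λ ⊗ₜ 1
  | .inr a, Λ => 1 ⊗ₜ ExteriorAlgebra.ι ℝ (Finsupp.single (a, Λ) 1)

/-- The (left) partial derivative `∂/∂s^A_Λ` of graded functions.  The odd ones are the graded
derivations with `∂(c^b_Σ φ) = (∂c^b_Σ) φ - c^b_Σ ∂φ`. -/
def partialS (W : TopologicalSpace.Opens (ChartSpace n E)) :
    E ⊕ O → Multiset (Fin n) → GrFun n E O W →ₗ[ℝ] GrFun n E O W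
  | .inl i, Λ => (bodyDy W i Λ).rTensor (OddJets n O)
  | .inr a, Λ => (CliffordAlgebra.contractLeft
      (Finsupp.lapply (a, Λ) : (O × Multiset (Fin n) →₀ ℝ) →ₗ[ℝ] ℝ)).lTensor (JetFun n E W)

theorem finite_bodyDy (f : JetFun n E W) :
    {p : E × Multiset (Fin n) | bodyDy W p.1 p.2 f ≠ 0}.Finite := by
  classical
  obtain ⟨S, g, hg, h⟩ := f.2
  refine (S.finite_toSet.union
    (Set.finite_range fun i : E => (i, (0 : Multiset (Fin n))))).subset ?_
  intro p hp
  by_contra hn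
  simp only [Set.mem_union, SetLike.mem_coe, Set.mem_range, not_or, not_exists] at hn
  refine hp ?_
  ext j
  refine (hasDerivAt_line hg h _ j).deriv.trans ?_
  have hz : jetTrunc S ((0, Pi.single (p.1, p.2) 1) : JetSpace n E) = 0 := by
    refine Prod.ext (Prod.ext rfl ?_) ?_
    · funext i
      exact Pi.single_eq_of_ne (hn.2 i) _
    · funext s
      refine Pi.single_eq_of_ne ?_ _
      intro hs
      have h2 := s.2
      rw [hs] at h2
      exact hn.1 h2
  have hz' := congrArg (fderiv ℝ g (jetTrunc S j.1)) hz
  rw [map_zero] at hz'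
  refine Eq.trans ?_ hz'
  congr!

theorem finite_contract (x : OddJets n O) :
    {p : O × Multiset (Fin n) | CliffordAlgebra.contractLeft
      (Finsupp.lapply p : (O × Multiset (Fin n) →₀ ℝ) →ₗ[ℝ] ℝ) x ≠ 0}.Finite := by
  classical
  induction x using CliffordAlgebra.left_induction with
  | algebraMap r => simp
  | add x y hx hy =>
    refine (hx.union hy).subset fun p hp => ?_
    by_contra hn
    simp only [Set.mem_union, Set.mem_ofPred_eq, not_or, not_not] at hn
    exact hp (by rw [map_add, hn.1, hn.2, add_zero])
  | ι_mul x m hx =>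
    refine (hx.union m.support.finite_toSet).subset fun p hp => ?_
    by_contra hn
    simp only [Set.mem_union, Set.mem_ofPred_eq, not_or, not_not, SetLike.mem_coe,
      Finsupp.mem_support_iff] at hn
    refine hp ?_
    rw [CliffordAlgebra.contractLeft_ι_mul, hn.1, Finsupp.lapply_apply, hn.2]
    simp

/-- A graded function depends on finitely many jet coordinates. -/
theorem finite_partialS (φ : GrFun n E O W) :
    {p : (E ⊕ O) × Multiset (Fin n) | partialS W p.1 p.2 φ ≠ 0}.Finite := by
  classical
  induction φ using TensorProduct.induction_on with
  | zero => simp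
  | add x y hx hy =>
    refine (hx.union hy).subset fun p hp => ?_
    by_contra hn
    simp only [Set.mem_union, Set.mem_ofPred_eq, not_or, not_not] at hn
    exact hp (by rw [map_add, hn.1, hn.2, add_zero])
  | tmul f x =>
    refine (((finite_bodyDy f).image fun p => ((Sum.inl p.1 : E ⊕ O), p.2)).union
      ((finite_contract x).image fun p => ((Sum.inr p.1 : E ⊕ O), p.2))).subset ?_
    rintro ⟨i | a, Λ⟩ hp
    · refine Or.inl ⟨(i, Λ), fun h => hp ?_, rfl⟩
      simp only [partialS, LinearMap.rTensor_tmul]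
      rw [h, TensorProduct.zero_tmul]
    · refine Or.inr ⟨(a, Λ), fun h => hp ?_, rfl⟩
      simp only [partialS, LinearMap.lTensor_tmul]
      rw [h, TensorProduct.tmul_zero]

/-- The total derivative `d_λ = ∂_λ + ∑_{A, Λ} s^A_{λ+Λ} ∂/∂s^A_Λ`, the sum being over all distinct
jet coordinates `s^A_Λ`. -/
def totalD (W : TopologicalSpace.Opens (ChartSpace n E)) (l : Fin n) :
    GrFun n E O W →ₗ[ℝ] GrFun n E O W :=
  (bodyDx W l).rTensor (OddJets n O) +
  { toFun := fun φ => ∑ᶠ p : (E ⊕ O) × Multiset (Fin n),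
      sCoord W p.1 (l ::ₘ p.2) * partialS W p.1 p.2 φ
    map_add' := fun φ ψ => by
      rw [← finsum_add_distrib]
      · simp [mul_add]
      · refine (finite_partialS φ).subset fun p hp h => hp ?_
        simp [h]
      · refine (finite_partialS ψ).subset fun p hp h => hp ?_
        simp [h]
    map_smul' := fun r φ => by
      rw [RingHom.id_apply, smul_finsum]
      simp }

/-- The iterated total derivative `d_Λ = d_{λ_1} ⋯ d_{λ_k}`, `Λ = (λ_1 … λ_k)` (the `d_λ` commute,
and are composed here in increasing order of the indices). -/
def totalDM (W : TopologicalSpace.Opens (ChartSpace n E)) (Λ : Multiset (Fin n)) :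
    GrFun n E O W →ₗ[ℝ] GrFun n E O W :=
  ((Λ.sort.map fun l => (totalD W l : Module.End ℝ (GrFun n E O W))).prod)

/-- The (left) variational derivative `δφ/δs^A = ∑_Λ (-1)^{|Λ|} d_Λ (∂φ/∂s^A_Λ)` of the density
`φ ω`, the sum being over all distinct jet coordinates `s^A_Λ` of `s^A`. -/
def varDeriv (A : E ⊕ O) (φ : GrFun n E O W) : GrFun n E O W :=
  ∑ᶠ Λ : Multiset (Fin n), (-1 : ℝ) ^ Λ.card • totalDM W Λ (partialS W A Λ φ)

/-! ## Horizontal forms -/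

/-- Horizontal graded `k`-forms `φ_{λ_1 … λ_k} dx^{λ_1} ∧ ⋯ ∧ dx^{λ_k}`: alternating `k`-linear
forms on constant vector fields of the base with values in graded functions. -/
abbrev HForm (n : ℕ) (E O : Type*) [Fintype E] (W : TopologicalSpace.Opens (ChartSpace n E))
    (k : ℕ) : Type _ := (Fin n → ℝ) [⋀^Fin k]→ₗ[ℝ] GrFun n E O W

/-- The total differential `d_H φ = dx^λ ∧ d_λ φ`. -/
def dH {k : ℕ} (φ : HForm n E O W k) : HForm n E O W (k + 1) :=
  AlternatingMap.alternatizeUncurryFin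
    (∑ l : Fin n, (LinearMap.proj l : (Fin n → ℝ) →ₗ[ℝ] ℝ).smulRight
      ((totalD W l).compAlternatingMap φ))

/-- `φ = d_H σ` for some horizontal form `σ` of degree one less (`φ = 0` in degree zero). -/
def IsDHExact : {k : ℕ} → HForm n E O W k → Prop
  | 0, φ => φ = 0
  | _ + 1, φ => ∃ σ, φ = dH σ

/-- The graded density `φ ω`, `ω = dx^1 ∧ ⋯ ∧ dx^n`. -/
def density (φ : GrFun n E O W) : HForm n E O W n :=
  (LinearMap.toSpanSingleton ℝ (GrFun n E O W) φ).compAlternatingMap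
    (Pi.basisFun ℝ (Fin n)).det

/-! ## Multi-index sums and the transformation `η` -/

/-- The sum of `F Λ` over multi-indices `Λ = (λ_1 … λ_k)` with `|Λ| = k < N`, where each of the
indices `λ_i` is summed over separately. -/
def sumTuples {M : Type*} [AddCommMonoid M] (N : ℕ) (F : Multiset (Fin n) → M) : M :=
  ∑ k ∈ Finset.range N, ∑ t : Fin k → Fin n, F (Multiset.map t Finset.univ.val)

/-- `η(f)^Λ = ∑_{|Σ| ≤ K - |Λ|} (-1)^{|Σ+Λ|} (|Σ+Λ|)! / (|Σ|! |Λ|!) d_Σ f^{Σ+Λ}` for a tuple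
`(f^Λ)`, `|Λ| ≤ K`. -/
def eta (K : ℕ) (f : Multiset (Fin n) → GrFun n E O W) (Λ : Multiset (Fin n)) :
    GrFun n E O W :=
  sumTuples (K + 1 - Λ.card) fun S =>
    ((-1 : ℝ) ^ (S + Λ).card *
      (((S + Λ).card.factorial : ℝ) / ((S.card.factorial : ℝ) * (Λ.card.factorial : ℝ)))) •
        totalDM W S (f (S + Λ))

/-! ## Ghosts -/

/-- The chart domain with the even ghosts adjoined as further fibre coordinates. -/
def ghostDom (GE : Type*) (W : TopologicalSpace.Opens (ChartSpace n E)) :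
    TopologicalSpace.Opens (ChartSpace n (E ⊕ GE)) where
  carrier := {q | (q.1, fun i => q.2 (.inl i)) ∈ W}
  is_open' := W.isOpen.preimage (by fun_prop)

/-- Graded functions of the fields `s^A`, `A : E ⊕ O`, and the ghosts `c^r`, `r : GE ⊕ GO`. -/
abbrev GhostFun (n : ℕ) (E O GE GO : Type*) [Fintype E] [Fintype GE]
    (W : TopologicalSpace.Opens (ChartSpace n E)) : Type _ :=
  GrFun n (E ⊕ GE) (O ⊕ GO) (ghostDom GE W)

/-- The ghost `c^r` as one of the coordinates. -/
def ghost : GE ⊕ GO → (E ⊕ GE) ⊕ (O ⊕ GO) := Sum.map Sum.inr Sum.inr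

variable [Fintype GE]

/-- Forgetting the ghosts on jets. -/
def forgetGhost (W : TopologicalSpace.Opens (ChartSpace n E)) (j : JetDom (ghostDom GE W)) :
    JetDom W :=
  ⟨(j.1.1, fun p => j.1.2 (.inl p.1, p.2)), j.2⟩

/-- Functions of the even fields as functions of the even fields and ghosts. -/
def bodyIncl (W : TopologicalSpace.Opens (ChartSpace n E)) :
    JetFun n E W →ₐ[ℝ] JetFun n (E ⊕ GE) (ghostDom GE W) where
  toFun f := ⟨fun j => f.1 (forgetGhost W j), by
    classical
    obtain ⟨S, g, hg, h⟩ := f.2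
    refine ⟨S.image fun p => ((.inl p.1 : E ⊕ GE), p.2),
      fun p => g ((p.1.1, fun i => p.1.2 (.inl i)),
        fun s => p.2 ⟨(.inl s.1.1, s.1.2), Finset.mem_image_of_mem _ s.2⟩), ?_, fun j => h _⟩
    refine hg.comp (t := (W : Set (ChartSpace n E)) ×ˢ Set.univ) ?_ ?_
    · exact ContDiff.contDiffOn (by fun_prop)
    · intro p hp
      exact ⟨hp.1, trivial⟩⟩
  map_one' := rfl
  map_mul' _ _ := rfl
  map_zero' := rfl
  map_add' _ _ := rfl
  commutes' _ := rfl

/-- The inclusion of the graded functions of the fields into those of the fields and ghosts. -/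
def incl : GrFun n E O W →ₐ[ℝ] GhostFun n E O GE GO W :=
  Algebra.TensorProduct.map (bodyIncl W)
    (ExteriorAlgebra.map (Finsupp.lmapDomain ℝ ℝ
      fun p : O × Multiset (Fin n) => ((.inl p.1 : O ⊕ GO), p.2)))

variable [Fintype GO]

/-- The components `u^A = ∑_{r, Λ} c^r_Λ η(Δ^A_r)^Λ` of the gauge symmetry associated with
`Δ_r^{A,Λ}`, `|Λ| ≤ K`. -/
def gaugeComp (K : ℕ) (Δ : GE ⊕ GO → E ⊕ O → Multiset (Fin n) → GrFun n E O W) (A : E ⊕ O) :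
    GhostFun n E O GE GO W :=
  ∑ r : GE ⊕ GO, sumTuples (K + 1) fun Λ =>
    sCoord (ghostDom GE W) (ghost r) Λ * incl (eta K (Δ r A) Λ)

end

end GradedJets

/-! The variational derivative with respect to any variable annihilates total divergences, so `δ_r`
kills `∑ u^A E_A` as soon as this density is `d_H`-exact (`varDeriv_eq_zero_of_isDHExact`). The same
derivative can be computed directly. The density is linear in the ghost jets, its coefficients
contain no ghosts, and each ghost jet stands at the far left, so a left derivative removes it
without a sign whatever its parity. What remains is `∑ (-1)^{|Λ|} d_Λ(η(Δ)^Λ E_A)`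
(`varDeriv_ghost_gaugeComp_mul`). Comparing the two results inside the larger algebra suffices,
because `incl` is injective.

The rest is algebra of the total derivatives. The Leibniz rule moves them onto `E_A`, and the new
coefficients are by construction `η` of the old ones (`sumTuples_totalDM_mul`). In terms of the
divergence operator `D f^Λ = ∑ d_λ f^{λ+Λ}`, the map `η` is a polynomial in `D` with signed binomial
coefficients depending on `|Λ|`. In `η ∘ η` the coefficient of `D^m` is a multiple of an alternating
row sum of binomials, which vanishes unless `m = 0`; hence `η` is an involution (`eta_eta`).

Three properties of `d_λ` are used: it is an even derivation, the `d_λ` commute, and `[∂/∂s^A_Λ,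
d_λ] = ∂/∂s^A_{Λ-λ}`, read as zero when `λ ∉ Λ`. On a pure tensor `d_λ` is a derivation of the
smooth factor plus a derivation of the Grassmann factor, so each property is checked on the factors.
-/

namespace GradedJets

noncomputable section

variable {n : ℕ} {E O GE GO : Type*}

/-! ## Derivations of the Grassmann algebra of odd jet coordinates -/

/-- The left interior product with the linear form `d` on the odd generators. -/
abbrev contract (d : (O × Multiset (Fin n) →₀ ℝ) →ₗ[ℝ] ℝ) : OddJets n O →ₗ[ℝ] OddJets n O :=
  CliffordAlgebra.contractLeft (Q := (0 : QuadraticForm ℝ (O × Multiset (Fin n) →₀ ℝ))) d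

theorem contract_ι_mul (d : (O × Multiset (Fin n) →₀ ℝ) →ₗ[ℝ] ℝ) (m : O × Multiset (Fin n) →₀ ℝ)
    (x : OddJets n O) : contract d (ExteriorAlgebra.ι ℝ m * x) =
      d m • x - ExteriorAlgebra.ι ℝ m * contract d x :=
  CliffordAlgebra.contractLeft_ι_mul ..

theorem ι_mul_ι_mul_swap (m m' : O × Multiset (Fin n) →₀ ℝ) (x : OddJets n O) :
    ExteriorAlgebra.ι ℝ m * (ExteriorAlgebra.ι ℝ m' * x) =
      -(ExteriorAlgebra.ι ℝ m' * (ExteriorAlgebra.ι ℝ m * x)) := by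
  rw [← mul_assoc, ← mul_assoc, ← neg_mul]
  congr 1
  exact eq_neg_of_add_eq_zero_left (ExteriorAlgebra.ι_add_mul_swap m m')

theorem finite_support_mul_contract (c : O × Multiset (Fin n) → OddJets n O) (x : OddJets n O) :
    (Function.support fun p : O × Multiset (Fin n) =>
      c p * contract (Finsupp.lapply p) x).Finite :=
  (finite_contract x).subset fun p hp h => hp (by
    change c p * contract (Finsupp.lapply p) x = 0
    rw [show contract (Finsupp.lapply p) x = 0 from h, mul_zero])

/-- The shift `c^a_Λ ↦ c^a_{λ+Λ}` of the odd generators. -/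
def oddShift (l : Fin n) : (O × Multiset (Fin n) →₀ ℝ) →ₗ[ℝ] (O × Multiset (Fin n) →₀ ℝ) :=
  Finsupp.lmapDomain ℝ ℝ fun p : O × Multiset (Fin n) => (p.1, l ::ₘ p.2)

/-- The total derivative `∑ c^a_{λ+Λ} ∂/∂c^a_Λ` on the Grassmann algebra of odd jet coordinates. -/
def oddTotal (l : Fin n) : OddJets n O →ₗ[ℝ] OddJets n O where
  toFun x := ∑ᶠ p : O × Multiset (Fin n),
    ExteriorAlgebra.ι ℝ (Finsupp.single (p.1, l ::ₘ p.2) 1) * contract (Finsupp.lapply p) x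
  map_add' x y := by
    rw [← finsum_add_distrib (finite_support_mul_contract _ x) (finite_support_mul_contract _ y)]
    simp only [map_add, mul_add]
  map_smul' r x := by
    rw [RingHom.id_apply, smul_finsum]
    simp only [map_smul, mul_smul_comm]

theorem oddTotal_apply (l : Fin n) (x : OddJets n O) :
    oddTotal l x = ∑ᶠ p : O × Multiset (Fin n),
      ExteriorAlgebra.ι ℝ (Finsupp.single (p.1, l ::ₘ p.2) 1) * contract (Finsupp.lapply p) x :=
  rfl

theorem oddTotal_algebraMap (l : Fin n) (r : ℝ) :
    oddTotal l (algebraMap ℝ (OddJets n O) r) = 0 := by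
  rw [oddTotal_apply]
  refine (finsum_congr fun p => ?_).trans finsum_zero
  rw [contract, CliffordAlgebra.contractLeft_algebraMap, mul_zero]

theorem finsum_smul_ι_single (l : Fin n) (m : O × Multiset (Fin n) →₀ ℝ) (x : OddJets n O) :
    ∑ᶠ p : O × Multiset (Fin n),
      m p • (ExteriorAlgebra.ι ℝ (Finsupp.single (p.1, l ::ₘ p.2) (1 : ℝ)) * x) =
        ExteriorAlgebra.ι ℝ (oddShift l m) * x := by
  rw [finsum_eq_sum_of_support_subset (s := m.support)]
  · rw [oddShift, Finsupp.lmapDomain_apply, Finsupp.mapDomain, Finsupp.sum, map_sum,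
      Finset.sum_mul]
    refine Finset.sum_congr rfl fun p _ => ?_
    rw [← smul_mul_assoc, ← map_smul, Finsupp.smul_single, smul_eq_mul, mul_one]
  · intro p hp
    simp only [Finset.mem_coe, Finsupp.mem_support_iff]
    intro h
    exact hp (by simp [h])

/-- The Leibniz rule on generators carries no sign: an odd multiplication after an odd contraction
is an even operation. Together with induction on products of generators this determines `oddTotal`.
-/
theorem oddTotal_ι_mul (l : Fin n) (m : O × Multiset (Fin n) →₀ ℝ) (x : OddJets n O) :
    oddTotal l (ExteriorAlgebra.ι ℝ m * x) =
      ExteriorAlgebra.ι ℝ (oddShift l m) * x + ExteriorAlgebra.ι ℝ m * oddTotal l x := by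
  rw [oddTotal_apply, oddTotal_apply, mul_finsum' _ _ (finite_support_mul_contract _ x),
    ← finsum_smul_ι_single, ← finsum_add_distrib]
  · refine finsum_congr fun p => ?_
    -- Two signs cancel: one from the contraction passing `m`, one from exchanging the shifted
    -- generator with `m`.
    rw [contract_ι_mul, mul_sub, ι_mul_ι_mul_swap, sub_neg_eq_add, mul_smul_comm]
    rfl
  · refine m.support.finite_toSet.subset fun p hp => ?_
    simp only [Finset.mem_coe, Finsupp.mem_support_iff]
    intro h
    exact hp (by simp [h])
  · refine (finite_support_mul_contract (fun p => ExteriorAlgebra.ι ℝ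
      (Finsupp.single (p.1, l ::ₘ p.2) 1)) x).subset fun p hp h => hp ?_
    simp only at h ⊢
    rw [h, mul_zero]

theorem oddTotal_mul (l : Fin n) (x y : OddJets n O) :
    oddTotal l (x * y) = oddTotal l x * y + x * oddTotal l y := by
  induction x using CliffordAlgebra.left_induction with
  | algebraMap r =>
    rw [oddTotal_algebraMap, zero_mul, zero_add, ← Algebra.smul_def, ← Algebra.smul_def, map_smul]
  | add x x' hx hx' =>
    rw [add_mul, map_add, map_add, hx, hx', add_mul, add_mul]
    abel
  | ι_mul x m hx =>
    change oddTotal l (ExteriorAlgebra.ι ℝ m * x * y) =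
      oddTotal l (ExteriorAlgebra.ι ℝ m * x) * y + ExteriorAlgebra.ι ℝ m * x * oddTotal l y
    rw [mul_assoc, oddTotal_ι_mul, oddTotal_ι_mul, hx, mul_add, add_mul]
    simp only [mul_assoc, add_assoc]

theorem oddShift_comm (l k : Fin n) (m : O × Multiset (Fin n) →₀ ℝ) :
    oddShift l (oddShift k m) = oddShift k (oddShift l m) := by
  simp only [oddShift, Finsupp.lmapDomain_apply, ← Finsupp.mapDomain_comp]
  congr 1
  funext p
  simp [Multiset.cons_swap l k]

theorem oddTotal_comm (l k : Fin n) (x : OddJets n O) :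
    oddTotal l (oddTotal k x) = oddTotal k (oddTotal l x) := by
  induction x using CliffordAlgebra.left_induction with
  | algebraMap r => rw [oddTotal_algebraMap, oddTotal_algebraMap, map_zero, map_zero]
  | add x x' hx hx' => simp only [map_add, hx, hx']
  | ι_mul x m hx =>
    change oddTotal l (oddTotal k (ExteriorAlgebra.ι ℝ m * x)) =
      oddTotal k (oddTotal l (ExteriorAlgebra.ι ℝ m * x))
    simp only [oddTotal_ι_mul, map_add, hx, oddShift_comm l k]
    abel

/-- The commutator of a contraction with an even derivation is again a contraction, along the
transpose of the derivation's action on generators. It suffices to compare both sides on generators.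
-/
theorem contract_oddTotal (d : (O × Multiset (Fin n) →₀ ℝ) →ₗ[ℝ] ℝ) (l : Fin n)
    (x : OddJets n O) :
    contract d (oddTotal l x) = oddTotal l (contract d x) + contract (d ∘ₗ oddShift l) x := by
  induction x using CliffordAlgebra.left_induction with
  | algebraMap r =>
    rw [oddTotal_algebraMap, contract, contract, CliffordAlgebra.contractLeft_algebraMap,
      CliffordAlgebra.contractLeft_algebraMap, map_zero, map_zero, zero_add]
  | add x x' hx hx' =>
    simp only [map_add, hx, hx']
    abel
  | ι_mul x m hx =>
    change contract d (oddTotal l (ExteriorAlgebra.ι ℝ m * x)) =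
      oddTotal l (contract d (ExteriorAlgebra.ι ℝ m * x)) +
        contract (d ∘ₗ oddShift l) (ExteriorAlgebra.ι ℝ m * x)
    rw [oddTotal_ι_mul, map_add]
    simp only [contract_ι_mul, hx, map_sub, map_smul, oddTotal_ι_mul, mul_add,
      LinearMap.comp_apply]
    abel

-- The transposed shift strips one `λ` from the multi-index: `c^a_{λ+Σ}` is `c^a_Λ` exactly when `λ
-- ∈ Λ` and `Σ = Λ - λ`.
open Classical in
theorem lapply_comp_oddShift (a : O) (Λ : Multiset (Fin n)) (l : Fin n) :
    (Finsupp.lapply (a, Λ) : (O × Multiset (Fin n) →₀ ℝ) →ₗ[ℝ] ℝ) ∘ₗ oddShift l =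
      if l ∈ Λ then Finsupp.lapply (a, Λ.erase l) else 0 := by
  ext ⟨b, S⟩
  simp only [oddShift, LinearMap.comp_apply, Finsupp.lsingle_apply, Finsupp.lmapDomain_apply,
    Finsupp.mapDomain_single, Finsupp.lapply_apply]
  split_ifs with hl
  · have h : ((b, l ::ₘ S) = (a, Λ)) ↔ (b, S) = (a, Λ.erase l) := by
      simp only [Prod.mk.injEq]
      refine and_congr_right fun _ => ⟨fun h => by simp [← h], fun h => ?_⟩
      rw [h, Multiset.cons_erase hl]
    simp only [Finsupp.lapply_apply, Finsupp.single_apply, h]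
  · rw [Finsupp.single_apply, if_neg]
    · rfl
    · intro h
      exact hl ((Prod.mk.inj h).2 ▸ Multiset.mem_cons_self _ _)

open Classical in
theorem contract_lapply_oddTotal (a : O) (Λ : Multiset (Fin n)) (l : Fin n) (x : OddJets n O) :
    contract (Finsupp.lapply (a, Λ)) (oddTotal l x) =
      oddTotal l (contract (Finsupp.lapply (a, Λ)) x) +
        if l ∈ Λ then contract (Finsupp.lapply (a, Λ.erase l)) x else 0 := by
  rw [contract_oddTotal, lapply_comp_oddShift]
  split_ifs
  · rfl
  · simp [contract]

theorem contract_map {O' : Type*} (g : (O × Multiset (Fin n) →₀ ℝ) →ₗ[ℝ]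
      (O' × Multiset (Fin n) →₀ ℝ)) (d : (O' × Multiset (Fin n) →₀ ℝ) →ₗ[ℝ] ℝ)
    (x : OddJets n O) :
    contract d (ExteriorAlgebra.map g x) = ExteriorAlgebra.map g (contract (d ∘ₗ g) x) := by
  induction x using CliffordAlgebra.left_induction with
  | algebraMap r =>
    rw [AlgHom.commutes, contract, contract, CliffordAlgebra.contractLeft_algebraMap,
      CliffordAlgebra.contractLeft_algebraMap, map_zero]
  | add x x' hx hx' => simp only [map_add, hx, hx']
  | ι_mul x m hx =>
    change contract d (ExteriorAlgebra.map g (ExteriorAlgebra.ι ℝ m * x)) =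
      ExteriorAlgebra.map g (contract (d ∘ₗ g) (ExteriorAlgebra.ι ℝ m * x))
    rw [map_mul, ExteriorAlgebra.map_apply_ι, contract_ι_mul, contract_ι_mul, hx, map_sub,
      map_smul, map_mul, ExteriorAlgebra.map_apply_ι]
    rfl

theorem oddTotal_map {O' : Type*} (g : (O × Multiset (Fin n) →₀ ℝ) →ₗ[ℝ]
      (O' × Multiset (Fin n) →₀ ℝ)) (l : Fin n) (hg : ∀ m, oddShift l (g m) = g (oddShift l m))
    (x : OddJets n O) :
    oddTotal l (ExteriorAlgebra.map g x) = ExteriorAlgebra.map g (oddTotal l x) := by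
  induction x using CliffordAlgebra.left_induction with
  | algebraMap r => rw [AlgHom.commutes, oddTotal_algebraMap, oddTotal_algebraMap, map_zero]
  | add x x' hx hx' => simp only [map_add, hx, hx']
  | ι_mul x m hx =>
    change oddTotal l (ExteriorAlgebra.map g (ExteriorAlgebra.ι ℝ m * x)) =
      ExteriorAlgebra.map g (oddTotal l (ExteriorAlgebra.ι ℝ m * x))
    rw [map_mul, ExteriorAlgebra.map_apply_ι, oddTotal_ι_mul, oddTotal_ι_mul, hx, map_add,
      map_mul, map_mul, ExteriorAlgebra.map_apply_ι, ExteriorAlgebra.map_apply_ι, hg]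
variable [Fintype E] {W : TopologicalSpace.Opens (ChartSpace n E)}

/-! ## Derivatives of smooth functions of finite jet order -/

theorem dirDeriv_apply_of_repr {f : JetFun n E W} {S : Finset (E × Multiset (Fin n))}
    {g : ChartSpace n E × (S → ℝ) → ℝ}
    (hg : ContDiffOn ℝ ∞ g ((W : Set (ChartSpace n E)) ×ˢ Set.univ))
    (hf : ∀ j : JetDom W, f.1 j = g (jetTrunc S j.1)) (v : JetSpace n E) (j : JetDom W) :
    (dirDeriv W v f).1 j = fderiv ℝ g (jetTrunc S j.1) (jetTrunc S v) :=
  (hasDerivAt_line hg hf v j).deriv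

theorem dirDeriv_mul (v : JetSpace n E) (f g : JetFun n E W) :
    dirDeriv W v (f * g) = dirDeriv W v f * g + f * dirDeriv W v g := by
  ext j
  have h := deriv_mul (differentiableAt_line f.2 v j) (differentiableAt_line g.2 v j)
  have h0 : ∀ k : JetFun n E W, extZero W k.1 (j.1 + (0 : ℝ) • v) = k.1 j := by
    intro k
    have : j.1 + (0 : ℝ) • v = j.1 := by simp
    rw [this, extZero, dif_pos j.2]
  rw [h0, h0] at h
  refine Eq.trans (congrArg (fun F => deriv F 0) ?_) h
  funext t
  by_cases ht : j.1 + t • v ∈ JetDom W <;> simp [extZero, ht]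

/-- Schwarz's theorem, applied to a representative in finitely many coordinates on an open set. -/
theorem dirDeriv_comm (v w : JetSpace n E) (f : JetFun n E W) :
    dirDeriv W v (dirDeriv W w f) = dirDeriv W w (dirDeriv W v f) := by
  obtain ⟨S, g, hg, h⟩ := f.2
  have hopen : IsOpen ((W : Set (ChartSpace n E)) ×ˢ (Set.univ : Set (S → ℝ))) :=
    W.isOpen.prod isOpen_univ
  have hsm : ∀ u : JetSpace n E, ContDiffOn ℝ ∞ (fun p => fderiv ℝ g p (jetTrunc S u))
      ((W : Set (ChartSpace n E)) ×ˢ Set.univ) := fun u =>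
    (hg.fderiv_of_isOpen hopen (by simp)).clm_apply contDiffOn_const
  ext j
  have hmem : jetTrunc S j.1 ∈ (W : Set (ChartSpace n E)) ×ˢ (Set.univ : Set (S → ℝ)) :=
    ⟨j.2, trivial⟩
  have hat := hg.contDiffAt (hopen.mem_nhds hmem)
  have hd : DifferentiableAt ℝ (fderiv ℝ g) (jetTrunc S j.1) :=
    ((hg.fderiv_of_isOpen (m := ∞) hopen (by simp)).contDiffAt
      (hopen.mem_nhds hmem)).differentiableAt (by simp)
  have hfd : ∀ u u' : JetSpace n E, fderiv ℝ (fun p => fderiv ℝ g p (jetTrunc S u))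
      (jetTrunc S j.1) (jetTrunc S u') =
        fderiv ℝ (fderiv ℝ g) (jetTrunc S j.1) (jetTrunc S u') (jetTrunc S u) := by
    intro u u'
    rw [fderiv_clm_apply hd (differentiableAt_const _)]
    simp
  rw [dirDeriv_apply_of_repr (hsm w) (fun j => dirDeriv_apply_of_repr hg h w j) v j,
    dirDeriv_apply_of_repr (hsm v) (fun j => dirDeriv_apply_of_repr hg h v j) w j, hfd, hfd]
  exact (hat.isSymmSndFDerivAt (by
    rw [minSmoothness_of_isRCLikeNormedField]
    exact WithTop.coe_le_coe.2 (le_top : (2 : ℕ∞) ≤ ⊤))).eq _ _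

theorem dirDeriv_yCoord (v : JetSpace n E) (i : E) (Λ : Multiset (Fin n)) :
    dirDeriv W v (yCoord W i Λ) = algebraMap ℝ _ (v.2 (i, Λ)) := by
  ext j
  change deriv (fun t : ℝ => extZero W (yCoord W i Λ).1 (j.1 + t • v)) 0 = v.2 (i, Λ)
  have h := hasDerivAt_line (W := W) (f := (yCoord W i Λ).1) (S := {(i, Λ)})
    (g := fun p => p.2 ⟨(i, Λ), by simp⟩) (ContDiff.contDiffOn (by fun_prop))
    (fun _ => rfl) v j
  rw [h.deriv]
  have := ((ContinuousLinearMap.proj (R := ℝ) (φ := fun _ : ({(i, Λ)} : Finset _) => ℝ)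
    ⟨(i, Λ), by simp⟩).comp
      (ContinuousLinearMap.snd ℝ (ChartSpace n E) _)).hasFDerivAt (x := jetTrunc {(i, Λ)} j.1)
  exact (congrArg (fun F => F (jetTrunc {(i, Λ)} v)) this.fderiv)

theorem bodyDx_mul (l : Fin n) (f g : JetFun n E W) :
    bodyDx W l (f * g) = bodyDx W l f * g + f * bodyDx W l g := dirDeriv_mul _ f g

theorem bodyDy_mul (i : E) (Λ : Multiset (Fin n)) (f g : JetFun n E W) :
    bodyDy W i Λ (f * g) = bodyDy W i Λ f * g + f * bodyDy W i Λ g := dirDeriv_mul _ f g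

theorem bodyDx_yCoord (l : Fin n) (i : E) (Λ : Multiset (Fin n)) :
    bodyDx W l (yCoord W i Λ) = 0 := by
  rw [bodyDx, dirDeriv_yCoord]
  simp

open Classical in
theorem bodyDy_yCoord (i k : E) (Λ S : Multiset (Fin n)) :
    bodyDy W i Λ (yCoord W k S) = if k = i ∧ S = Λ then 1 else 0 := by
  rw [bodyDy, dirDeriv_yCoord]
  simp only [Pi.single_apply, Prod.mk.injEq]
  split_ifs <;> simp

theorem finite_support_mul_bodyDy (c : E × Multiset (Fin n) → JetFun n E W) (f : JetFun n E W) :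
    (Function.support fun p : E × Multiset (Fin n) => c p * bodyDy W p.1 p.2 f).Finite :=
  (finite_bodyDy f).subset fun p hp h => hp (by simp [h])

/-- The total derivative `∂_λ + ∑ y^i_{λ+Λ} ∂/∂y^i_Λ` of smooth functions of finite jet order. -/
def bodyTotal (W : TopologicalSpace.Opens (ChartSpace n E)) (l : Fin n) :
    JetFun n E W →ₗ[ℝ] JetFun n E W :=
  bodyDx W l +
  { toFun := fun f => ∑ᶠ p : E × Multiset (Fin n), yCoord W p.1 (l ::ₘ p.2) * bodyDy W p.1 p.2 f
    map_add' := fun f g => by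
      rw [← finsum_add_distrib (finite_support_mul_bodyDy _ f) (finite_support_mul_bodyDy _ g)]
      simp [mul_add]
    map_smul' := fun r f => by
      rw [RingHom.id_apply, smul_finsum]
      simp }

theorem bodyTotal_apply (l : Fin n) (f : JetFun n E W) :
    bodyTotal W l f = bodyDx W l f +
      ∑ᶠ p : E × Multiset (Fin n), yCoord W p.1 (l ::ₘ p.2) * bodyDy W p.1 p.2 f := rfl

theorem bodyTotal_eq_sum (l : Fin n) (f : JetFun n E W) {T : Finset (E × Multiset (Fin n))}
    (hT : ∀ p ∉ T, bodyDy W p.1 p.2 f = 0) :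
    bodyTotal W l f = bodyDx W l f +
      ∑ p ∈ T, yCoord W p.1 (l ::ₘ p.2) * bodyDy W p.1 p.2 f := by
  rw [bodyTotal_apply, finsum_eq_sum_of_support_subset]
  intro p hp
  by_contra h
  exact hp (by simp [hT p h])

theorem bodyTotal_mul (l : Fin n) (f g : JetFun n E W) :
    bodyTotal W l (f * g) = bodyTotal W l f * g + f * bodyTotal W l g := by
  have h1 := finite_support_mul_bodyDy (fun p => yCoord W p.1 (l ::ₘ p.2)) f
  have h2 := finite_support_mul_bodyDy (fun p => yCoord W p.1 (l ::ₘ p.2)) g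
  simp only [bodyTotal_apply, bodyDx_mul, bodyDy_mul]
  rw [add_mul, mul_add, finsum_mul' _ _ h1, mul_finsum' _ _ h2, add_add_add_comm,
    ← finsum_add_distrib (h1.subset fun p hp h => hp (by simp [h]))
      (h2.subset fun p hp h => hp (by simp [h]))]
  congr 1
  refine finsum_congr fun p => ?_
  ring

theorem bodyTotal_yCoord (l : Fin n) (i : E) (Λ : Multiset (Fin n)) :
    bodyTotal W l (yCoord W i Λ) = yCoord W i (l ::ₘ Λ) := by
  classical
  rw [bodyTotal_eq_sum l _ (T := {(i, Λ)}), bodyDx_yCoord]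
  · simp [bodyDy_yCoord]
  · rintro ⟨k, S⟩ hp
    rw [bodyDy_yCoord, if_neg]
    rintro ⟨rfl, rfl⟩
    simp at hp

theorem exists_bodyDy_finset (f : JetFun n E W) :
    ∃ T : Finset (E × Multiset (Fin n)), ∀ p ∉ T, bodyDy W p.1 p.2 f = 0 :=
  ⟨(finite_bodyDy f).toFinset, fun p hp => by simpa using hp⟩

theorem bodyTotal_comm (l m : Fin n) (f : JetFun n E W) :
    bodyTotal W l (bodyTotal W m f) = bodyTotal W m (bodyTotal W l f) := by
  obtain ⟨T, hT⟩ := exists_bodyDy_finset f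
  -- One finite set `T` serves all the sums, since derivatives of `f` depend on no more jet
  -- coordinates than `f` does. Exchanging `l` and `m` swaps the two mixed sums and fixes the other
  -- terms, up to symmetry of second derivatives.
  have key : ∀ l m : Fin n, bodyTotal W l (bodyTotal W m f) =
      bodyDx W l (bodyDx W m f) +
      ∑ p ∈ T, yCoord W p.1 (l ::ₘ p.2) * bodyDx W m (bodyDy W p.1 p.2 f) +
      (∑ p ∈ T, yCoord W p.1 (l ::ₘ m ::ₘ p.2) * bodyDy W p.1 p.2 f +
      (∑ p ∈ T, yCoord W p.1 (m ::ₘ p.2) * bodyDx W l (bodyDy W p.1 p.2 f) +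
      ∑ p ∈ T, ∑ q ∈ T, yCoord W p.1 (m ::ₘ p.2) * (yCoord W q.1 (l ::ₘ q.2) *
        bodyDy W q.1 q.2 (bodyDy W p.1 p.2 f)))) := by
    intro l m
    have hcx : ∀ p : E × Multiset (Fin n), bodyDy W p.1 p.2 (bodyDx W m f) =
        bodyDx W m (bodyDy W p.1 p.2 f) := fun p => dirDeriv_comm _ _ f
    have hcy : ∀ p q : E × Multiset (Fin n), bodyDy W p.1 p.2 (bodyDy W q.1 q.2 f) =
        bodyDy W q.1 q.2 (bodyDy W p.1 p.2 f) := fun p q => dirDeriv_comm _ _ f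
    rw [bodyTotal_eq_sum m f hT, map_add, map_sum,
      bodyTotal_eq_sum l (bodyDx W m f) (T := T) (fun p hp => by rw [hcx, hT p hp, map_zero])]
    simp only [hcx]
    congr 1
    simp only [bodyTotal_mul, bodyTotal_yCoord]
    rw [Finset.sum_add_distrib, ← Finset.sum_add_distrib (s := T)
      (f := fun p => yCoord W p.1 (m ::ₘ p.2) * bodyDx W l (bodyDy W p.1 p.2 f))]
    congr 1
    refine Finset.sum_congr rfl fun p _ => ?_
    rw [bodyTotal_eq_sum l _ (T := T) (fun q hq => by rw [hcy, hT q hq, map_zero]), mul_add,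
      Finset.mul_sum]
  rw [key l m, key m l, Finset.sum_comm]
  have hc : bodyDx W l (bodyDx W m f) = bodyDx W m (bodyDx W l f) := dirDeriv_comm _ _ f
  have hd : ∀ p q : E × Multiset (Fin n), yCoord W q.1 (m ::ₘ q.2) * (yCoord W p.1 (l ::ₘ p.2) *
        bodyDy W p.1 p.2 (bodyDy W q.1 q.2 f)) = yCoord W p.1 (l ::ₘ p.2) *
        (yCoord W q.1 (m ::ₘ q.2) * bodyDy W q.1 q.2 (bodyDy W p.1 p.2 f)) := by
    intro p q
    rw [show bodyDy W p.1 p.2 (bodyDy W q.1 q.2 f) = bodyDy W q.1 q.2 (bodyDy W p.1 p.2 f) from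
      dirDeriv_comm _ _ f]
    ring
  simp only [hd, hc, Multiset.cons_swap m l]
  abel

open Classical in
theorem bodyDy_bodyTotal (i : E) (Λ : Multiset (Fin n)) (l : Fin n) (f : JetFun n E W) :
    bodyDy W i Λ (bodyTotal W l f) = bodyTotal W l (bodyDy W i Λ f) +
      if l ∈ Λ then bodyDy W i (Λ.erase l) f else 0 := by
  obtain ⟨T₀, hT₀⟩ := exists_bodyDy_finset f
  -- The enlarged set surely contains the one index whose coefficient `y^i_{λ+Σ}` is `y^i_Λ`, even
  -- if `f` does not depend on that coordinate.
  let T := insert (i, Λ.erase l) T₀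
  have hT : ∀ p ∉ T, bodyDy W p.1 p.2 f = 0 := fun p hp =>
    hT₀ p fun h => hp (Finset.mem_insert_of_mem h)
  have hcx : bodyDy W i Λ (bodyDx W l f) = bodyDx W l (bodyDy W i Λ f) := dirDeriv_comm _ _ f
  have hcy : ∀ p : E × Multiset (Fin n), bodyDy W p.1 p.2 (bodyDy W i Λ f) =
      bodyDy W i Λ (bodyDy W p.1 p.2 f) := fun p => dirDeriv_comm _ _ f
  rw [bodyTotal_eq_sum l f hT, map_add, map_sum, hcx,
    bodyTotal_eq_sum l (bodyDy W i Λ f) (T := T) (fun q hq => by rw [hcy, hT q hq, map_zero]),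
    add_assoc]
  congr 1
  simp only [bodyDy_mul, hcy]
  rw [Finset.sum_add_distrib, add_comm]
  congr 1
  simp only [bodyDy_yCoord, ite_mul, one_mul, zero_mul]
  split_ifs with hl
  · rw [Finset.sum_eq_single (i, Λ.erase l)]
    · rw [if_pos ⟨rfl, Multiset.cons_erase hl⟩]
    · rintro ⟨k, S⟩ - hne
      rw [if_neg]
      rintro ⟨rfl, h⟩
      exact hne (by simp [← h])
    · exact fun h => absurd (Finset.mem_insert_self _ _) h
  · refine Finset.sum_eq_zero fun p _ => if_neg ?_
    rintro ⟨-, h⟩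
    exact hl (h ▸ Multiset.mem_cons_self _ _)

/-! ## Total derivatives of graded functions -/

theorem exists_contract_finset (x : OddJets n O) :
    ∃ T : Finset (O × Multiset (Fin n)), ∀ p ∉ T, contract (Finsupp.lapply p) x = 0 :=
  ⟨(finite_contract x).toFinset, fun p hp => by simpa using hp⟩

theorem oddTotal_eq_sum (l : Fin n) (x : OddJets n O) {T : Finset (O × Multiset (Fin n))}
    (hT : ∀ p ∉ T, contract (Finsupp.lapply p) x = 0) :
    oddTotal l x = ∑ p ∈ T,
      ExteriorAlgebra.ι ℝ (Finsupp.single (p.1, l ::ₘ p.2) 1) * contract (Finsupp.lapply p) x := by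
  rw [oddTotal_apply, finsum_eq_sum_of_support_subset]
  intro p hp
  by_contra h
  exact hp (by simp only [hT p h, mul_zero])

theorem partialS_inl_tmul (i : E) (Λ : Multiset (Fin n)) (f : JetFun n E W) (x : OddJets n O) :
    partialS W (.inl i) Λ (f ⊗ₜ[ℝ] x) = bodyDy W i Λ f ⊗ₜ x := rfl

theorem partialS_inr_tmul (a : O) (Λ : Multiset (Fin n)) (f : JetFun n E W) (x : OddJets n O) :
    partialS W (.inr a) Λ (f ⊗ₜ[ℝ] x) = f ⊗ₜ contract (Finsupp.lapply (a, Λ)) x := rfl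

/-- This splits `d_λ` into its even and odd parts, and so reduces identities for graded functions to
the two tensor factors. -/
theorem totalD_tmul (l : Fin n) (f : JetFun n E W) (x : OddJets n O) :
    totalD W l (f ⊗ₜ[ℝ] x) = bodyTotal W l f ⊗ₜ x + f ⊗ₜ oddTotal l x := by
  obtain ⟨T, hT⟩ := exists_bodyDy_finset f
  obtain ⟨T', hT'⟩ := exists_contract_finset x
  have h : totalD W l (f ⊗ₜ[ℝ] x) = bodyDx W l f ⊗ₜ x +
      ∑ᶠ p : (E ⊕ O) × Multiset (Fin n),
        sCoord W p.1 (l ::ₘ p.2) * partialS W p.1 p.2 (f ⊗ₜ[ℝ] x) := rfl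
  rw [h, bodyTotal_eq_sum l f hT, oddTotal_eq_sum l x hT', TensorProduct.add_tmul, add_assoc,
    TensorProduct.sum_tmul, TensorProduct.tmul_sum,
    -- Separates the jet coordinates into even and odd ones.
    ← finsum_comp_equiv (Equiv.sumProdDistrib E O (Multiset (Fin n))).symm,
    finsum_eq_sum_of_support_subset (s := T.disjSum T'), Finset.sum_disjSum]
  · congr 2
    · refine Finset.sum_congr rfl fun p _ => ?_
      simp [sCoord, partialS_inl_tmul]
    · refine Finset.sum_congr rfl fun p _ => ?_
      simp [sCoord, partialS_inr_tmul]
  · rintro (p | p) hp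
    · simp only [Finset.mem_coe, Finset.inl_mem_disjSum]
      by_contra hn
      refine hp ?_
      simp [partialS_inl_tmul, hT p hn]
    · simp only [Finset.mem_coe, Finset.inr_mem_disjSum]
      by_contra hn
      refine hp ?_
      simp only [Equiv.sumProdDistrib_symm_apply_right, partialS_inr_tmul, Prod.mk.eta, hT' p hn,
        TensorProduct.tmul_zero, mul_zero]

theorem totalD_mul (l : Fin n) (φ ψ : GrFun n E O W) :
    totalD W l (φ * ψ) = totalD W l φ * ψ + φ * totalD W l ψ := by
  induction φ using TensorProduct.induction_on with
  | zero => simp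
  | add φ φ' h h' =>
    simp only [add_mul, map_add, h, h']
    abel
  | tmul f x =>
    induction ψ using TensorProduct.induction_on with
    | zero => simp
    | add ψ ψ' h h' =>
      simp only [mul_add, map_add, h, h']
      abel
    | tmul g y =>
      simp only [Algebra.TensorProduct.tmul_mul_tmul, totalD_tmul, bodyTotal_mul, oddTotal_mul,
        add_mul, mul_add, TensorProduct.add_tmul, TensorProduct.tmul_add]
      abel

theorem totalD_comm (l m : Fin n) (φ : GrFun n E O W) :
    totalD W l (totalD W m φ) = totalD W m (totalD W l φ) := by
  induction φ using TensorProduct.induction_on with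
  | zero => simp
  | add φ φ' h h' => simp only [map_add, h, h']
  | tmul f x =>
    simp only [totalD_tmul, map_add, bodyTotal_comm l m, oddTotal_comm l m]
    abel

-- Besides passing through `d_λ`, the partial derivative hits the one coefficient `s^A_{λ+Σ}` with
-- `λ+Σ = Λ`. This commutator is what makes variational derivatives vanish on divergences.
open Classical in
theorem partialS_totalD (A : E ⊕ O) (Λ : Multiset (Fin n)) (l : Fin n) (φ : GrFun n E O W) :
    partialS W A Λ (totalD W l φ) = totalD W l (partialS W A Λ φ) +
      if l ∈ Λ then partialS W A (Λ.erase l) φ else 0 := by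
  induction φ using TensorProduct.induction_on with
  | zero => simp
  | add φ φ' h h' =>
    simp only [map_add, h, h']
    split_ifs <;> abel
  | tmul f x =>
    rcases A with i | a
    · simp only [totalD_tmul, map_add, partialS_inl_tmul, bodyDy_bodyTotal, TensorProduct.add_tmul]
      split_ifs
      · abel
      · rw [TensorProduct.zero_tmul]
        abel
    · simp only [totalD_tmul, map_add, partialS_inr_tmul, contract_lapply_oddTotal,
        TensorProduct.tmul_add]
      split_ifs
      · abel
      · rw [TensorProduct.tmul_zero]
        abel

theorem totalDM_zero (φ : GrFun n E O W) : totalDM W 0 φ = φ := by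
  simp [totalDM]

theorem totalDM_cons (l : Fin n) (Λ : Multiset (Fin n)) (φ : GrFun n E O W) :
    totalDM W (l ::ₘ Λ) φ = totalD W l (totalDM W Λ φ) := by
  have hperm : ((l ::ₘ Λ).sort).Perm (l :: Λ.sort) := by
    rw [← Multiset.coe_eq_coe, Multiset.sort_eq, ← Multiset.cons_coe, Multiset.sort_eq]
  -- Since the `d_λ` commute, the sorted order in the definition of `totalDM` is immaterial.
  have hprod := (hperm.map fun l => (totalD W l : Module.End ℝ (GrFun n E O W))).prod_eq'
    (by
      refine List.pairwise_of_forall_mem_list ?_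
      intro a ha b hb
      obtain ⟨i, -, rfl⟩ := List.mem_map.1 ha
      obtain ⟨j, -, rfl⟩ := List.mem_map.1 hb
      exact LinearMap.ext fun φ => totalD_comm i j φ)
  rw [totalDM, hprod, List.map_cons, List.prod_cons]
  rfl

theorem totalDM_totalD (l : Fin n) (Λ : Multiset (Fin n)) (φ : GrFun n E O W) :
    totalDM W Λ (totalD W l φ) = totalD W l (totalDM W Λ φ) := by
  induction Λ using Multiset.induction_on with
  | empty => rw [totalDM_zero, totalDM_zero]
  | cons k Λ ih => rw [totalDM_cons, totalDM_cons, ih, totalD_comm]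

/-! ## Graded functions of fields and ghosts -/

variable [Fintype GE]

/-- A pulled-back function is constant along the ghost directions, so only the projection of `v` to
the fields matters. -/
theorem dirDeriv_bodyIncl (v : JetSpace n (E ⊕ GE)) (f : JetFun n E W) :
    dirDeriv (ghostDom GE W) v (bodyIncl W f) =
      bodyIncl W (dirDeriv W (v.1, fun p => v.2 (.inl p.1, p.2)) f) := by
  ext j
  change deriv (fun t : ℝ => extZero (ghostDom GE W) (bodyIncl W f).1 (j.1 + t • v)) 0 =
    deriv (fun t : ℝ => extZero W f.1 ((forgetGhost W j).1 +
      t • ((v.1, fun p => v.2 (.inl p.1, p.2)) : JetSpace n E))) 0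
  congr 1

theorem dirDeriv_zero (f : JetFun n E W) : dirDeriv W 0 f = 0 := by
  ext j
  change deriv (fun t : ℝ => extZero W f.1 (j.1 + t • (0 : JetSpace n E))) 0 = 0
  simp

theorem bodyDx_bodyIncl (l : Fin n) (f : JetFun n E W) :
    bodyDx (ghostDom GE W) l (bodyIncl W f) = bodyIncl W (bodyDx W l f) :=
  dirDeriv_bodyIncl _ f

theorem bodyDy_inl_bodyIncl (i : E) (Λ : Multiset (Fin n)) (f : JetFun n E W) :
    bodyDy (ghostDom GE W) (.inl i) Λ (bodyIncl W f) = bodyIncl W (bodyDy W i Λ f) := by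
  rw [bodyDy, dirDeriv_bodyIncl, bodyDy]
  congr 3
  refine Prod.ext rfl ?_
  funext p
  classical
  simp only [Pi.single_apply, Prod.ext_iff, Sum.inl.injEq]

theorem bodyDy_inr_bodyIncl (r : GE) (Λ : Multiset (Fin n)) (f : JetFun n E W) :
    bodyDy (ghostDom GE W) (.inr r) Λ (bodyIncl W f) = 0 := by
  rw [bodyDy, dirDeriv_bodyIncl]
  refine Eq.trans (congrArg (bodyIncl W) ?_) (map_zero _)
  refine Eq.trans (congrArg (fun u => dirDeriv W u f) ?_) (dirDeriv_zero f)
  refine Prod.ext rfl (funext fun p => ?_)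
  simp

theorem bodyIncl_yCoord (i : E) (Λ : Multiset (Fin n)) :
    bodyIncl (GE := GE) W (yCoord W i Λ) = yCoord (ghostDom GE W) (.inl i) Λ := rfl

theorem bodyTotal_bodyIncl (l : Fin n) (f : JetFun n E W) :
    bodyTotal (ghostDom GE W) l (bodyIncl W f) = bodyIncl W (bodyTotal W l f) := by
  obtain ⟨T, hT⟩ := exists_bodyDy_finset f
  rw [bodyTotal_eq_sum l f hT, map_add, map_sum, bodyTotal_apply, bodyDx_bodyIncl,
    ← finsum_comp_equiv (Equiv.sumProdDistrib E GE (Multiset (Fin n))).symm,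
    finsum_eq_sum_of_support_subset (s := T.disjSum ∅), Finset.sum_disjSum, Finset.sum_empty,
    add_zero]
  · congr 1
    refine Finset.sum_congr rfl fun p _ => ?_
    rw [map_mul, bodyIncl_yCoord, ← bodyDy_inl_bodyIncl]
    rfl
  · rintro (p | p) hp
    · simp only [Finset.mem_coe, Finset.inl_mem_disjSum]
      by_contra hn
      refine hp ?_
      simp [bodyDy_inl_bodyIncl, hT p hn]
    · refine absurd ?_ hp
      simp [bodyDy_inr_bodyIncl]

theorem incl_tmul (f : JetFun n E W) (x : OddJets n O) :
    (incl (f ⊗ₜ[ℝ] x) : GhostFun n E O GE GO W) =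
      bodyIncl W f ⊗ₜ ExteriorAlgebra.map (Finsupp.lmapDomain ℝ ℝ
        fun p : O × Multiset (Fin n) => ((.inl p.1 : O ⊕ GO), p.2)) x := rfl

theorem totalD_incl (l : Fin n) (φ : GrFun n E O W) :
    totalD (ghostDom GE W) l (incl φ : GhostFun n E O GE GO W) = incl (totalD W l φ) := by
  induction φ using TensorProduct.induction_on with
  | zero => simp
  | add φ φ' h h' => simp only [map_add, h, h']
  | tmul f x =>
    rw [incl_tmul, totalD_tmul, totalD_tmul, map_add, incl_tmul, incl_tmul, bodyTotal_bodyIncl,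
      oddTotal_map]
    intro m
    simp only [oddShift, Finsupp.lmapDomain_apply, ← Finsupp.mapDomain_comp]
    rfl

theorem totalDM_incl (Λ : Multiset (Fin n)) (φ : GrFun n E O W) :
    totalDM (ghostDom GE W) Λ (incl φ : GhostFun n E O GE GO W) = incl (totalDM W Λ φ) := by
  induction Λ using Multiset.induction_on with
  | empty => rw [totalDM_zero, totalDM_zero]
  | cons l Λ ih => rw [totalDM_cons, totalDM_cons, ih, totalD_incl]

-- The ghost is the leftmost factor and `incl φ` is ghost-free, so the left derivative just extracts
-- the coefficient, with no sign for either parity of ghost.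
open Classical in
theorem partialS_ghost_mul_incl (r r' : GE ⊕ GO) (Λ S : Multiset (Fin n)) (φ : GrFun n E O W) :
    partialS (ghostDom GE W) (ghost r) Λ (sCoord (ghostDom GE W) (ghost r') S *
      (incl φ : GhostFun n E O GE GO W)) = if r' = r ∧ S = Λ then incl φ else 0 := by
  induction φ using TensorProduct.induction_on with
  | zero => simp
  | add φ φ' h h' =>
    simp only [map_add, mul_add, h, h']
    split_ifs <;> simp
  | tmul f x =>
    rw [incl_tmul]
    rcases r with r | r <;> rcases r' with r' | r'
    · simp only [ghost, Sum.map_inl, sCoord, Algebra.TensorProduct.tmul_mul_tmul,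
        partialS_inl_tmul, bodyDy_mul, bodyDy_yCoord, bodyDy_inr_bodyIncl, mul_zero, add_zero,
        one_mul, Sum.inl.injEq, Sum.inr.injEq]
      split_ifs <;> simp
    · simp only [ghost, Sum.map_inl, Sum.map_inr, sCoord, Algebra.TensorProduct.tmul_mul_tmul,
        partialS_inl_tmul, one_mul, bodyDy_inr_bodyIncl, TensorProduct.zero_tmul]
      simp
    · simp only [ghost, Sum.map_inl, Sum.map_inr, sCoord, Algebra.TensorProduct.tmul_mul_tmul,
        partialS_inr_tmul, one_mul, contract_map]
      -- The linear form reading off an odd ghost jet vanishes on the generators coming from the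
      -- fields.
      rw [show (Finsupp.lapply (Sum.inr r, Λ) : ((O ⊕ GO) × Multiset (Fin n) →₀ ℝ) →ₗ[ℝ] ℝ) ∘ₗ
        (Finsupp.lmapDomain ℝ ℝ
          fun p : O × Multiset (Fin n) => ((.inl p.1 : O ⊕ GO), p.2)) = 0 by
        ext p
        simp [Finsupp.lmapDomain_apply, Finsupp.mapDomain_single]]
      simp [contract]
    · simp only [ghost, Sum.map_inr, sCoord, Algebra.TensorProduct.tmul_mul_tmul,
        partialS_inr_tmul, one_mul, contract_ι_mul, contract_map]
      rw [show (Finsupp.lapply (Sum.inr r, Λ) : ((O ⊕ GO) × Multiset (Fin n) →₀ ℝ) →ₗ[ℝ] ℝ) ∘ₗ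
        (Finsupp.lmapDomain ℝ ℝ
          fun p : O × Multiset (Fin n) => ((.inl p.1 : O ⊕ GO), p.2)) = 0 by
        ext p
        simp [Finsupp.lmapDomain_apply, Finsupp.mapDomain_single]]
      simp only [contract, map_zero, LinearMap.zero_apply, mul_zero, sub_zero,
        Finsupp.lapply_apply, Finsupp.single_apply, Prod.mk.injEq, Sum.inr.injEq]
      split_ifs <;> simp

/-! ## Variational derivatives of total divergences -/

theorem finite_partialS_index (A : E ⊕ O) (φ : GrFun n E O W) :
    {Λ : Multiset (Fin n) | partialS W A Λ φ ≠ 0}.Finite :=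
  ((finite_partialS φ).preimage (f := fun Λ => (A, Λ))
    (Prod.mk_right_injective A).injOn).subset fun _ h => h

theorem finite_support_varDeriv (A : E ⊕ O) (φ : GrFun n E O W)
    (T : Multiset (Fin n) → GrFun n E O W →ₗ[ℝ] GrFun n E O W) :
    (Function.support fun Λ : Multiset (Fin n) => T Λ (partialS W A Λ φ)).Finite :=
  (finite_partialS_index A φ).subset fun Λ hΛ h => hΛ (by simp only [h, map_zero])

theorem varDeriv_eq_finsum (A : E ⊕ O) (φ : GrFun n E O W) :
    varDeriv A φ = ∑ᶠ Λ : Multiset (Fin n),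
      ((-1 : ℝ) ^ Λ.card • totalDM W Λ) (partialS W A Λ φ) := rfl

theorem varDeriv_zero (A : E ⊕ O) : varDeriv A (0 : GrFun n E O W) = 0 := by
  simp [varDeriv]

theorem varDeriv_add (A : E ⊕ O) (φ ψ : GrFun n E O W) :
    varDeriv A (φ + ψ) = varDeriv A φ + varDeriv A ψ := by
  simp only [varDeriv_eq_finsum]
  rw [← finsum_add_distrib (finite_support_varDeriv _ _ _) (finite_support_varDeriv _ _ _)]
  simp only [map_add]

theorem varDeriv_sum {ι : Type*} (A : E ⊕ O) (s : Finset ι) (φ : ι → GrFun n E O W) :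
    varDeriv A (∑ i ∈ s, φ i) = ∑ i ∈ s, varDeriv A (φ i) :=
  map_sum (AddMonoidHom.mk' (varDeriv A) (varDeriv_add A)) φ s

/-- Total derivatives are annihilated by the variational derivatives. -/
theorem varDeriv_totalD (A : E ⊕ O) (l : Fin n) (φ : GrFun n E O W) :
    varDeriv A (totalD W l φ) = 0 := by
  classical
  have h1 := finite_support_varDeriv A φ fun Λ =>
    ((-1 : ℝ) ^ Λ.card • totalDM W Λ) ∘ₗ totalD W l
  -- The contribution of the commutator `[∂/∂s^A_Λ, d_λ]`; it lives on multi-indices containing `l`.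
  let H : Multiset (Fin n) → GrFun n E O W := fun Λ => ((-1 : ℝ) ^ Λ.card • totalDM W Λ)
    (if l ∈ Λ then partialS W A (Λ.erase l) φ else 0)
  have hinj : Function.Injective fun Λ : Multiset (Fin n) => l ::ₘ Λ :=
    fun _ _ h => (Multiset.cons_inj_right l).1 h
  have hH0 : ∀ Λ, H Λ ≠ 0 → l ∈ Λ ∧ partialS W A (Λ.erase l) φ ≠ 0 := by
    intro Λ hΛ
    by_cases hl : l ∈ Λ
    · refine ⟨hl, fun h => hΛ ?_⟩
      simp only [H, if_pos hl, h, map_zero]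
    · exact absurd (by simp only [H, if_neg hl, map_zero]) hΛ
  have h2 : (Function.support H).Finite := by
    refine ((finite_partialS_index A φ).image fun Λ => l ::ₘ Λ).subset fun Λ hΛ => ?_
    obtain ⟨hl, h⟩ := hH0 Λ hΛ
    exact ⟨Λ.erase l, h, Multiset.cons_erase hl⟩
  -- Reindexed by `Λ ↦ l ::ₘ Λ`, each term acquires one extra sign and one extra `d_l`, and so
  -- cancels the corresponding term of the first sum.
  have h3 : ∑ᶠ Λ, H Λ = ∑ᶠ Λ, H (l ::ₘ Λ) := by
    rw [← finsum_mem_range hinj, ← finsum_mem_univ]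
    refine finsum_mem_inter_support_eq' _ _ _ fun Λ hΛ => ?_
    simp only [Set.mem_univ, Set.mem_range, true_iff]
    exact ⟨Λ.erase l, Multiset.cons_erase (hH0 Λ hΛ).1⟩
  rw [varDeriv_eq_finsum]
  simp only [partialS_totalD, map_add]
  refine (finsum_add_distrib h1 h2).trans ?_
  rw [h3, ← finsum_add_distrib h1 (h2.preimage hinj.injOn)]
  refine (finsum_congr fun Λ => ?_).trans finsum_zero
  simp only [H, LinearMap.comp_apply, LinearMap.smul_apply, Multiset.mem_cons_self, if_true,
    Multiset.erase_cons_head, Multiset.card_cons, totalDM_totalD, totalDM_cons, pow_succ,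
    mul_neg, mul_one, neg_smul, add_neg_cancel]

theorem density_apply_basis (φ : GrFun n E O W) :
    density φ (Pi.basisFun ℝ (Fin n)) = φ := by
  change (Pi.basisFun ℝ (Fin n)).det (Pi.basisFun ℝ (Fin n)) • φ = φ
  rw [Module.Basis.det_self, one_smul]

theorem alternatingMap_sum_apply {ι R M N κ : Type*} [CommSemiring R] [AddCommMonoid M]
    [Module R M] [AddCommMonoid N] [Module R N] (s : Finset ι) (f : ι → M [⋀^κ]→ₗ[R] N)
    (v : κ → M) : (∑ i ∈ s, f i) v = ∑ i ∈ s, f i v :=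
  map_sum ({ toFun := fun g => g v, map_zero' := rfl, map_add' := fun _ _ => rfl } :
    (M [⋀^κ]→ₗ[R] N) →+ N) f s

/-- Evaluated on the coordinate frame, `d_H σ` is a real linear combination of total derivatives of
components of `σ`. The dimension `n` is also the form degree, hence the case split; for `n = 0`
exactness means vanishing. -/
theorem varDeriv_eq_zero_of_isDHExact (A : E ⊕ O) :
    ∀ {n : ℕ} {W : TopologicalSpace.Opens (ChartSpace n E)} {φ : GrFun n E O W},
      IsDHExact (density φ) → varDeriv A φ = 0
  | 0, W, φ, h => by
    have h' : density φ = 0 := h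
    rw [← density_apply_basis φ, h', AlternatingMap.zero_apply, varDeriv_zero]
  | n + 1, W, φ, h => by
    obtain ⟨σ, hσ⟩ := h
    rw [← density_apply_basis φ, hσ, dH, AlternatingMap.alternatizeUncurryFin_apply, varDeriv_sum]
    refine Finset.sum_eq_zero fun i _ => ?_
    rw [LinearMap.sum_apply, alternatingMap_sum_apply, Finset.smul_sum, varDeriv_sum]
    refine Finset.sum_eq_zero fun l _ => ?_
    rw [LinearMap.smulRight_apply, AlternatingMap.smul_apply,
      LinearMap.compAlternatingMap_apply, ← map_smul, ← map_zsmul, varDeriv_totalD]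

/-! ## Sums over multi-indices of a fixed length -/

/-- The sum of `F Λ` over multi-indices `Λ = (λ_1 … λ_k)`, each `λ_i` being summed separately. -/
def tupleSum {M : Type*} [AddCommMonoid M] (k : ℕ) (F : Multiset (Fin n) → M) : M :=
  ∑ t : Fin k → Fin n, F (Multiset.map t Finset.univ.val)

theorem sumTuples_eq {M : Type*} [AddCommMonoid M] (N : ℕ) (F : Multiset (Fin n) → M) :
    sumTuples N F = ∑ k ∈ Finset.range N, tupleSum k F := rfl

theorem tupleSum_zero {M : Type*} [AddCommMonoid M] (F : Multiset (Fin n) → M) :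
    tupleSum 0 F = F 0 := by
  simp [tupleSum]

theorem tupleSum_succ {M : Type*} [AddCommMonoid M] (k : ℕ) (F : Multiset (Fin n) → M) :
    tupleSum (k + 1) F = ∑ l : Fin n, tupleSum k fun Λ => F (l ::ₘ Λ) := by
  simp only [tupleSum]
  rw [← Fintype.sum_prod_type', ← (Fin.consEquiv fun _ : Fin (k + 1) => Fin n).sum_comp]
  refine Finset.sum_congr rfl fun p _ => ?_
  congr 1
  rw [Fin.univ_val_map, Fin.univ_val_map, Multiset.cons_coe, List.ofFn_succ]
  simp [Fin.consEquiv]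

theorem tupleSum_congr {M : Type*} [AddCommMonoid M] (k : ℕ) {F G : Multiset (Fin n) → M}
    (h : ∀ Λ, Λ.card = k → F Λ = G Λ) : tupleSum k F = tupleSum k G :=
  Finset.sum_congr rfl fun _ _ => h _ (by simp)

theorem tupleSum_add {M : Type*} [AddCommMonoid M] (k : ℕ) (F G : Multiset (Fin n) → M) :
    (tupleSum k fun Λ => F Λ + G Λ) = tupleSum k F + tupleSum k G :=
  Finset.sum_add_distrib

theorem tupleSum_sum {M ι : Type*} [AddCommMonoid M] (k : ℕ) (s : Finset ι)
    (F : ι → Multiset (Fin n) → M) :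
    (tupleSum k fun Λ => ∑ i ∈ s, F i Λ) = ∑ i ∈ s, tupleSum k (F i) :=
  Finset.sum_comm

theorem tupleSum_smul {M : Type*} [AddCommGroup M] [Module ℝ M] (k : ℕ) (r : ℝ)
    (F : Multiset (Fin n) → M) : (tupleSum k fun Λ => r • F Λ) = r • tupleSum k F :=
  Finset.smul_sum.symm

/-! ## The transformation `η` -/

/-- The total divergence `f ↦ (Λ ↦ ∑_λ d_λ f^{λ+Λ})` of tuples of graded functions. -/
def totalDiv (W : TopologicalSpace.Opens (ChartSpace n E)) (f : Multiset (Fin n) → GrFun n E O W)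
    (Λ : Multiset (Fin n)) : GrFun n E O W := ∑ l : Fin n, totalD W l (f (l ::ₘ Λ))

/-- Because each index is summed separately, no multiplicities appear and the `k`-fold contraction
is the `k`-th iterate of a single operator. -/
theorem tupleSum_totalDM (k : ℕ) (f : Multiset (Fin n) → GrFun n E O W)
    (Λ : Multiset (Fin n)) :
    (tupleSum k fun S => totalDM W S (f (S + Λ))) = (totalDiv W)^[k] f Λ := by
  induction k generalizing f with
  | zero => simp [tupleSum_zero, totalDM_zero]
  | succ k ih =>
    rw [Function.iterate_succ_apply, ← ih, tupleSum_succ, ← tupleSum_sum]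
    congr 1
    funext S
    rw [totalDiv, map_sum]
    refine Finset.sum_congr rfl fun l _ => ?_
    rw [totalDM_cons, totalDM_totalD, Multiset.cons_add]

/-- The coefficients `(-1)^{k+l} (k+l)! / (k! l!)` of the transformation `η`. -/
def etaCoeff (k l : ℕ) : ℝ := (-1) ^ (k + l) * ((k + l).choose k : ℝ)

theorem eta_eq_sum (K : ℕ) (f : Multiset (Fin n) → GrFun n E O W) (Λ : Multiset (Fin n)) :
    eta K f Λ = ∑ k ∈ Finset.range (K + 1 - Λ.card),
      etaCoeff k Λ.card • (totalDiv W)^[k] f Λ := by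
  rw [eta, sumTuples_eq]
  refine Finset.sum_congr rfl fun k _ => ?_
  rw [← tupleSum_totalDM, ← tupleSum_smul]
  refine tupleSum_congr k fun S hS => ?_
  rw [Multiset.card_add, hS, etaCoeff, Nat.cast_add_choose]

/-- The value of `D^k` at `Λ` reads its argument at length `k + |Λ|`; this shifts the second index
of the coefficient and shortens the range by `k`. -/
theorem iterate_totalDiv_eta (K k : ℕ) (f : Multiset (Fin n) → GrFun n E O W)
    (Λ : Multiset (Fin n)) :
    (totalDiv W)^[k] (eta K f) Λ = ∑ j ∈ Finset.range (K + 1 - Λ.card - k),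
      etaCoeff j (k + Λ.card) • (totalDiv W)^[j + k] f Λ := by
  induction k generalizing Λ with
  | zero => simp [eta_eq_sum]
  | succ k ih =>
    rw [Function.iterate_succ_apply', totalDiv]
    simp only [ih, map_sum, map_smul, Multiset.card_cons]
    rw [Finset.sum_comm]
    refine Finset.sum_congr (by congr 1; omega) fun j _ => ?_
    rw [← Finset.smul_sum, show k + (Λ.card + 1) = k + 1 + Λ.card by omega, ← add_assoc,
      Function.iterate_succ_apply', totalDiv]

/-- By `C(m+l,k+l) C(k+l,l) = C(m+l,l) C(m,k)` the sum is a multiple of `∑ (-1)^k C(m,k) = (1-1)^m`.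
-/
theorem sum_etaCoeff_mul (m l : ℕ) :
    ∑ k ∈ Finset.range (m + 1), etaCoeff k l * etaCoeff (m - k) (k + l) =
      if m = 0 then 1 else 0 := by
  have h : ∀ k ∈ Finset.range (m + 1), etaCoeff k l * etaCoeff (m - k) (k + l) =
      (-1) ^ m * ((m + l).choose l : ℝ) * (((-1) ^ k * (m.choose k : ℤ) : ℤ) : ℝ) := by
    intro k hk
    have hkm : k ≤ m := Nat.lt_succ_iff.1 (Finset.mem_range.1 hk)
    have h1 : m - k + (k + l) = m + l := by omega
    have h2 : (m + l).choose (m - k) = (m + l).choose (k + l) :=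
      Nat.choose_symm_of_eq_add (by omega)
    have h3 : (k + l).choose k = (k + l).choose l := Nat.choose_symm_add
    have h4 : (m + l).choose (k + l) * (k + l).choose l = (m + l).choose l * m.choose k := by
      have := Nat.choose_mul (n := m + l) (k := k + l) (s := l) (by omega)
      simpa using this
    have h4' : ((m + l).choose (k + l) : ℝ) * ((k + l).choose l : ℝ) =
        ((m + l).choose l : ℝ) * (m.choose k : ℝ) := by exact_mod_cast h4
    have h5 : ((-1 : ℝ) ^ l) * (-1) ^ l = 1 := by rw [← mul_pow]; simp
    rw [etaCoeff, etaCoeff, h1, h2, h3]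
    push_cast
    calc _ = ((m + l).choose (k + l) : ℝ) * ((k + l).choose l : ℝ) *
          ((-1) ^ k * (-1) ^ m * ((-1) ^ l * (-1) ^ l)) := by ring
      _ = _ := by rw [h4', h5]; ring
  rw [Finset.sum_congr rfl h, ← Finset.mul_sum, ← Int.cast_sum, Int.alternating_sum_range_choose]
  split_ifs with hm
  · subst hm
    simp
  · simp

theorem eta_eta {K : ℕ} {f : Multiset (Fin n) → GrFun n E O W}
    (hf : ∀ Λ, K < Multiset.card Λ → f Λ = 0) (Λ : Multiset (Fin n)) :
    eta K (eta K f) Λ = f Λ := by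
  rw [eta_eq_sum]
  simp only [iterate_totalDiv_eta, Finset.smul_sum, smul_smul]
  -- Collects the terms by the total power `m = j + k` of the divergence operator.
  rw [← Finset.sum_range_diag_flip (K + 1 - Λ.card) fun k j =>
    (etaCoeff k Λ.card * etaCoeff j (k + Λ.card)) • (totalDiv W)^[j + k] f Λ]
  have h : ∀ m ∈ Finset.range (K + 1 - Λ.card), ∑ k ∈ Finset.range (m + 1),
      (etaCoeff k Λ.card * etaCoeff (m - k) (k + Λ.card)) • (totalDiv W)^[m - k + k] f Λ =
        if m = 0 then f Λ else 0 := by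
    intro m _
    have h' : ∀ k ∈ Finset.range (m + 1),
        (etaCoeff k Λ.card * etaCoeff (m - k) (k + Λ.card)) • (totalDiv W)^[m - k + k] f Λ =
        (etaCoeff k Λ.card * etaCoeff (m - k) (k + Λ.card)) • (totalDiv W)^[m] f Λ := by
      intro k hk
      rw [Nat.sub_add_cancel (Nat.lt_succ_iff.1 (Finset.mem_range.1 hk))]
    rw [Finset.sum_congr rfl h', ← Finset.sum_smul, sum_etaCoeff_mul]
    split_ifs with hm
    · subst hm
      simp
    · simp
  rw [Finset.sum_congr rfl h, Finset.sum_ite_eq']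
  split_ifs with h0
  · rfl
  -- For `|Λ| > K` the truncated range is empty and the double transform is zero, so `f` must vanish
  -- there too.
  · refine (hf Λ ?_).symm
    rw [Finset.mem_range] at h0
    omega

/-- Binomial Leibniz rule: of the `k` derivatives, `i` fall on `e`, and the others are contracted
with `f` into divergences. By symmetry only their number matters, whence the factor `C(k,i)`. -/
theorem tupleSum_totalDM_mul (k : ℕ) (f : Multiset (Fin n) → GrFun n E O W) (e : GrFun n E O W) :
    (tupleSum k fun S => totalDM W S (f S * e)) =
      ∑ ij ∈ Finset.HasAntidiagonal.antidiagonal k, k.choose ij.1 •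
        tupleSum ij.1 fun S => (totalDiv W)^[ij.2] f S * totalDM W S e := by
  induction k generalizing f e with
  | zero => simp [tupleSum_zero, totalDM_zero]
  | succ k ih =>
    -- Pascal's rule, matching the two outcomes for one derivative split off in `hstep`: it acts on
    -- `f`, or on `e`.
    rw [Finset.sum_antidiagonal_choose_succ_nsmul fun i j =>
      tupleSum i fun S => (totalDiv W)^[j] f S * totalDM W S e]
    have hiter : ∀ (j : ℕ) (l : Fin n), (totalDiv W)^[j] (fun S => f (l ::ₘ S)) =
        fun S => (totalDiv W)^[j] f (l ::ₘ S) := by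
      intro j l
      induction j with
      | zero => rfl
      | succ j ihj =>
        rw [Function.iterate_succ_apply', ihj, Function.iterate_succ_apply']
        funext S
        simp only [totalDiv, Multiset.cons_swap l]
    have hstep : (tupleSum (k + 1) fun S => totalDM W S (f S * e)) =
        (tupleSum k fun S => totalDM W S (totalDiv W f S * e)) +
          ∑ l : Fin n, tupleSum k fun S => totalDM W S (f (l ::ₘ S) * totalD W l e) := by
      rw [tupleSum_succ, ← tupleSum_sum, ← tupleSum_sum, ← tupleSum_add]
      congr 1
      funext S
      rw [totalDiv, Finset.sum_mul, map_sum, ← Finset.sum_add_distrib]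
      refine Finset.sum_congr rfl fun l _ => ?_
      rw [totalDM_cons, ← totalDM_totalD, totalD_mul, map_add]
    rw [hstep, ih]
    congr 1
    simp only [ih]
    rw [Finset.sum_comm]
    refine Finset.sum_congr rfl fun ij hij => ?_
    rw [← Finset.smul_sum, tupleSum_succ,
      -- Pascal's rule leaves `k.choose j` in this sum, where the induction hypothesis has `k.choose
      -- i`.
      Nat.choose_symm_of_eq_add (Finset.HasAntidiagonal.mem_antidiagonal.1 hij).symm]
    congr 1
    refine Finset.sum_congr rfl fun l _ => ?_
    simp only [hiter, totalDM_cons, totalDM_totalD]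

/-- Summation by parts: `∑ (-1)^{|Λ|} d_Λ (f^Λ e) = ∑ η(f)^Λ d_Λ e`. -/
theorem sumTuples_totalDM_mul (K : ℕ) (f : Multiset (Fin n) → GrFun n E O W)
    (e : GrFun n E O W) :
    (sumTuples (K + 1) fun Λ => (-1 : ℝ) ^ Multiset.card Λ • totalDM W Λ (f Λ * e)) =
      sumTuples (K + 1) fun Λ => eta K f Λ * totalDM W Λ e := by
  let R : ℕ → ℕ → GrFun n E O W := fun i j =>
    tupleSum i fun S => (totalDiv W)^[j] f S * totalDM W S e
  have hl : ∀ k, (tupleSum k fun Λ => (-1 : ℝ) ^ Multiset.card Λ • totalDM W Λ (f Λ * e)) =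
      ∑ i ∈ Finset.range (k + 1), etaCoeff (k - i) i • R i (k - i) := by
    intro k
    rw [tupleSum_congr k (G := fun Λ => (-1 : ℝ) ^ k • totalDM W Λ (f Λ * e))
      (fun Λ h => by rw [h]), tupleSum_smul, tupleSum_totalDM_mul,
      Finset.Nat.sum_antidiagonal_eq_sum_range_succ fun i j => k.choose i • R i j,
      Finset.smul_sum]
    refine Finset.sum_congr rfl fun i hi => ?_
    have hik : i ≤ k := Nat.lt_succ_iff.1 (Finset.mem_range.1 hi)
    rw [etaCoeff, Nat.sub_add_cancel hik, Nat.choose_symm hik, mul_smul, Nat.cast_smul_eq_nsmul]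
  have hr : ∀ i, (tupleSum i fun Λ => eta K f Λ * totalDM W Λ e) =
      ∑ j ∈ Finset.range (K + 1 - i), etaCoeff j i • R i j := by
    intro i
    simp only [R, ← tupleSum_smul, ← tupleSum_sum]
    refine tupleSum_congr i fun Λ hΛ => ?_
    rw [eta_eq_sum, hΛ, Finset.sum_mul]
    simp only [smul_mul_assoc]
  rw [sumTuples_eq, sumTuples_eq]
  simp only [hl, hr]
  -- Both sides are the sum of the same terms over `i + j ≤ K`, grouped by `i + j` on the left and
  -- by `i` on the right.
  exact Finset.sum_range_diag_flip (K + 1) fun i j => etaCoeff j i • R i j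

/-! ## Variational derivatives with respect to the ghosts -/

open Classical in
theorem varDeriv_ghost_mul_incl (r r' : GE ⊕ GO) (S : Multiset (Fin n)) (φ : GrFun n E O W) :
    varDeriv (ghost r) (sCoord (ghostDom GE W) (ghost r') S *
      (incl φ : GhostFun n E O GE GO W)) =
        if r' = r then incl ((-1 : ℝ) ^ S.card • totalDM W S φ) else 0 := by
  rw [varDeriv_eq_finsum]
  simp only [partialS_ghost_mul_incl]
  rw [finsum_eq_single _ S]
  · split_ifs with h h' h'
    · rw [LinearMap.smul_apply, totalDM_incl, map_smul]
    · exact absurd h.1 h'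
    · exact absurd ⟨h', rfl⟩ h
    · rw [map_zero]
  · intro Λ hΛ
    rw [if_neg fun h => hΛ h.2.symm, map_zero]

/-- Injective on each factor, hence on the tensor product, everything being flat over the field `ℝ`.
This lets identities found among fields and ghosts descend to the fields. -/
theorem incl_injective : Function.Injective (incl : GrFun n E O W → GhostFun n E O GE GO W) := by
  have h1 : Function.Injective (bodyIncl (GE := GE) W) := by
    intro f g h
    ext j
    -- Every jet of the fields lifts to one with all even ghost coordinates zero.
    have hj := congrFun (congrArg Subtype.val h)
      ⟨(j.1.1, fun p => Sum.elim (fun i => j.1.2 (i, p.2)) (fun _ => 0) p.1), j.2⟩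
    exact hj
  have h2 : Function.Injective (Finsupp.lmapDomain ℝ ℝ
      fun p : O × Multiset (Fin n) => ((.inl p.1 : O ⊕ GO), p.2)) :=
    Finsupp.mapDomain_injective fun p q h => by
      simpa [Prod.ext_iff] using h
  exact TensorProduct.map_injective_of_flat_flat (bodyIncl W).toLinearMap
    (ExteriorAlgebra.map _).toLinearMap h1 (ExteriorAlgebra.map_injective_field (LinearMap.ker_eq_bot.2 h2))

variable [Fintype GO]

theorem varDeriv_ghost_gaugeComp_mul [Fintype O] (K : ℕ)
    (Δ : GE ⊕ GO → E ⊕ O → Multiset (Fin n) → GrFun n E O W) (e : E ⊕ O → GrFun n E O W)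
    (r : GE ⊕ GO) :
    varDeriv (ghost r) (∑ A : E ⊕ O, gaugeComp K Δ A * incl (e A)) =
      incl (∑ A : E ⊕ O, sumTuples (K + 1) fun Λ =>
        (-1 : ℝ) ^ Multiset.card Λ • totalDM W Λ (eta K (Δ r A) Λ * e A)) := by
  classical
  simp only [gaugeComp, sumTuples, Finset.sum_mul, mul_assoc, ← map_mul, varDeriv_sum,
    varDeriv_ghost_mul_incl, map_sum]
  refine Finset.sum_congr rfl fun A _ => ?_
  rw [Finset.sum_eq_single r]
  · simp only [if_true]
  · intro r' _ hr'
    simp only [if_neg hr', Finset.sum_const_zero]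
  · exact fun h => absurd (Finset.mem_univ r) h

end

end GradedJets

/-! ### The Noether identities -/

open GradedJets in
theorem theorem825 {n : ℕ} {E O GE GO : Type*} [Fintype E] [Fintype O] [Fintype GE] [Fintype GO]
    (W : TopologicalSpace.Opens (ChartSpace n E)) (L : GrFun n E O W) (K : ℕ)
    (Δ : GE ⊕ GO → E ⊕ O → Multiset (Fin n) → GrFun n E O W)
    (hΔ : ∀ r A Λ, K < Multiset.card Λ → Δ r A Λ = 0)
    (hu : IsDHExact (density (∑ A : E ⊕ O, gaugeComp K Δ A * incl (varDeriv A L))))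
    (r : GE ⊕ GO) :
    varDeriv (ghost r) (∑ A : E ⊕ O, gaugeComp K Δ A * incl (varDeriv A L)) =
        incl (∑ A : E ⊕ O, sumTuples (K + 1) fun Λ =>
          (-1 : ℝ) ^ Multiset.card Λ • totalDM W Λ (eta K (Δ r A) Λ * varDeriv A L)) ∧
      (∑ A : E ⊕ O, sumTuples (K + 1) fun Λ =>
          (-1 : ℝ) ^ Multiset.card Λ • totalDM W Λ (eta K (Δ r A) Λ * varDeriv A L)) =
        (∑ A : E ⊕ O, sumTuples (K + 1) fun Λ =>
          eta K (eta K (Δ r A)) Λ * totalDM W Λ (varDeriv A L)) ∧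
      (∑ A : E ⊕ O, sumTuples (K + 1) fun Λ =>
          eta K (eta K (Δ r A)) Λ * totalDM W Λ (varDeriv A L)) = 0 ∧
      (∀ A Λ, eta K (eta K (Δ r A)) Λ = Δ r A Λ) ∧
      (∑ A : E ⊕ O, sumTuples (K + 1) fun Λ =>
          Δ r A Λ * totalDM W Λ (varDeriv A L)) = 0 := by
  have h1 := varDeriv_ghost_gaugeComp_mul K Δ (fun A => varDeriv A L) r
  have h2 : (∑ A : E ⊕ O, sumTuples (K + 1) fun Λ =>
          (-1 : ℝ) ^ Multiset.card Λ • totalDM W Λ (eta K (Δ r A) Λ * varDeriv A L)) =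
        (∑ A : E ⊕ O, sumTuples (K + 1) fun Λ =>
          eta K (eta K (Δ r A)) Λ * totalDM W Λ (varDeriv A L)) :=
    Finset.sum_congr rfl fun A _ => sumTuples_totalDM_mul K _ _
  have h3 : ∀ A Λ, eta K (eta K (Δ r A)) Λ = Δ r A Λ := fun A => eta_eta (hΔ r A)
  have h4 : (∑ A : E ⊕ O, sumTuples (K + 1) fun Λ =>
          eta K (eta K (Δ r A)) Λ * totalDM W Λ (varDeriv A L)) = 0 := by
    rw [← h2]
    refine incl_injective (GE := GE) (GO := GO) ?_
    rw [← h1, varDeriv_eq_zero_of_isDHExact _ hu, map_zero]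
  refine ⟨h1, h2, h4, h3, ?_⟩
  simpa only [h3] using h4
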